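/- All graphs are finite and simple. For a graph $G$ with adjacency matrix $A(G)$ and diagonal degree matrix $D(G)$ and a real $\alpha\ge 0$, let $\Theta(G,\alpha)$ be the largest eigenvalue of $A(G)+\alpha D(G)$. A graph $G$ in a class $\mathcal G$ of graphs is called $\Theta_\alpha$-maximal in $\mathcal G$ if $\Theta(G',\alpha)\le\Theta(G,\alpha)$ for all $G'\in\mathcal G$. A unicyclic graph is a connected graph with as many edges as vertices, and $\vee$ denotes the join of graphs. Let $n,t$ be integers with $0\le t\le n-3$, and let $\pi=(d_1\ge d_2\ge\dots\ge d_n)$ be such that the class $\mathscr U(\pi,t)$ of graphs with degree sequence $\pi$ that are isomorphic to $K_t\vee H$ for some unicyclic graph $H$ on $n-t$ vertices is non-empty. Put $d^*_j=d_j-t$ for $t+1\le j\le n$ and $\pi^*=(d^*_{t+1},\dots,d^*_n)$. If not all entries of $\pi^*$ are equal to $2$, let $U_{\pi^*}$ be the following graph with vertices $v_{t+1},\dots,v_n$: the root $v_{t+1}$ is joined to the next $d^*_{t+1}$ vertices $v_{t+2},v_{t+3},\dots$; the vertices $v_{t+2}$ and $v_{t+3}$ are joined to each other; then, one after the other for $j=t+2,t+3,\dots,n$,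 the vertex $v_j$ is joined to the next $d^*_j-2$ (if $j\in\{t+2,t+3\}$) or $d^*_j-1$ (if $j\ge t+4$) vertices of the list that have not yet been attached to the graph. Define $$U_\pi^{(t)}=\begin{cases}K_t\vee C_{n-t}&\text{if all entries of }\pi^*\text{ are }2,\\ K_t\vee U_{\pi^*}&\text{otherwise.}\end{cases}$$ **Theorem.** The $\Theta_\alpha$-maximal graph of $\mathscr U(\pi,t)$ is unique up to isomorphism and is $U_\pi^{(t)}$: a graph $G$ on $n$ vertices is $\Theta_\alpha$-maximal in $\mathscr U(\pi,t)$ if and only if $G\cong U_\pi^{(t)}$. Moreover, if not all entries of $\pi^*$ are $2$, then $U_{\pi^*}$ is a unicyclic graph in which $v_j$ has degree $d^*_j$ for every $j$; its only cycle is the triangle on the three vertices $v_{t+1},v_{t+2},v_{t+3}$ (of the three highest degrees); and $v_{t+1}\prec v_{t+2}\prec\dots\prec v_n$ is a BFS-ordering of it, that is, degrees are non-increasing and distances $h$ to $v_{t+1}$ are non-decreasing along the order, and whenever $v\in N(u)\setminus N(x)$, $y\in N(x)\setminus N(u)$, $h(u)=h(x)=h(v)-1=h(y)-1$ and $u\prec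 x$, then $v\prec y$. -/

import Mathlib

open scoped Classical in
/-- The general matrix `A(G) + α D(G)`. -/
noncomputable def generalMatrix {V : Type*} [Fintype V] (α : ℝ) (G : SimpleGraph V) :
    Matrix V V ℝ :=
  G.adjMatrix ℝ + α • G.degMatrix ℝ

/-- The general spectral radius `Θ(G, α)`: the maximal eigenvalue of `A(G) + α D(G)`. The matrix is
real symmetric, so for nonempty `V` its set of eigenvalues is finite and nonempty and the supremum
is a maximum. -/
noncomputable def generalSpectralRadius {V : Type*} [Fintype V] (G : SimpleGraph V) (α : ℝ) : ℝ :=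
  open scoped Classical in
  sSup {μ : ℝ | Module.End.HasEigenvalue (Matrix.toLin' (generalMatrix α G)) μ}

/-- `G` is a `Θ_α`-maximal graph of the class `𝒢`. -/
def IsThetaMaximal {V : Type*} [Fintype V] (α : ℝ) (𝒢 : Set (SimpleGraph V))
    (G : SimpleGraph V) : Prop :=
  G ∈ 𝒢 ∧ ∀ G' ∈ 𝒢, generalSpectralRadius G' α ≤ generalSpectralRadius G α

/-- The join of two graphs: their disjoint union together with all edges between them. -/
def graphJoin {V W : Type*} (G : SimpleGraph V) (H : SimpleGraph W) : SimpleGraph (V ⊕ W) :=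
  (G ⊕g H) ⊔ completeBipartiteGraph V W

/-- A `c`-cyclic graph: connected, with `|E| = |V| + c - 1`. -/
def IsCyclicOfRank {V : Type*} (c : ℕ) (H : SimpleGraph V) : Prop :=
  H.Connected ∧ Nat.card H.edgeSet + 1 = Nat.card V + c

/-- `d 0, …, d (m - 1)` lists the degrees of the vertices of `G`, in some order of the vertices. -/
def HasDegreeSequence {V : Type*} {m : ℕ} (G : SimpleGraph V) (d : Fin m → ℕ) : Prop :=
  ∃ e : Fin m ≃ V, ∀ i, (G.neighborSet (e i)).ncard = d i

/-- The class `Γ(π, t; c)`: the graphs on `n` vertices with degree sequence `π` that are, up to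
isomorphism, the join of `K_t` and a `c`-cyclic graph on `n - t` vertices. -/
def coneClass {n : ℕ} (π : Fin n → ℕ) (t c : ℕ) : Set (SimpleGraph (Fin n)) :=
  {G | HasDegreeSequence G π ∧ ∃ H : SimpleGraph (Fin (n - t)), IsCyclicOfRank c H ∧
    Nonempty (G ≃g graphJoin (⊤ : SimpleGraph (Fin t)) H)}

/-- The reduced sequence `π* = (d_{t+1} - t, …, d_n - t)`, indexed from `0`. -/
def reducedSeq {n : ℕ} (π : Fin n → ℕ) (t : ℕ) : Fin (n - t) → ℕ :=
  fun i => π ⟨t + i.val, by omega⟩ - t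

/-- The number of children (neighbours in the next layer) of vertex `i` in the breadth-first
construction of the unicyclic graph with degrees `d`: all neighbours for the root `0`; all but the
root and each other for the two vertices `1, 2` that close the triangle; all but the parent for
every other vertex. -/
def childCount {m : ℕ} (d : Fin m → ℕ) (i : Fin m) : ℕ :=
  if i.val = 0 then d i else if i.val ≤ 2 then d i - 2 else d i - 1

/-- The first child of `i`. The vertices are numbered layer by layer, and inside each layer in the
order of their parents, so the children of `0, 1, 2, …` are consecutive blocks of `1, 2, 3, …`. -/
def firstChild {m : ℕ} (d : Fin m → ℕ) (i : Fin m) : ℕ :=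
  1 + ∑ j ∈ Finset.univ.filter (fun j => j < i), childCount d j

/-- The unicyclic graph `U_d`, built by breadth-first search: the root `0` has the children
`1, …, d 0`, the vertices `1` and `2` are joined by an edge, and then each vertex in turn receives
as many new children as its prescribed degree still requires. -/
def bfsUnicyclic {m : ℕ} (d : Fin m → ℕ) : SimpleGraph (Fin m) :=
  SimpleGraph.fromRel fun i k =>
    (firstChild d i ≤ k.val ∧ k.val < firstChild d i + childCount d i) ∨
      (i.val = 1 ∧ k.val = 2)

/-- The natural order of `Fin m` is a BFS-ordering of the graph `H`, with first vertex `r`. -/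
structure IsBFSOrdering {m : ℕ} (H : SimpleGraph (Fin m)) (r : Fin m) : Prop where
  root_le : ∀ v, r ≤ v
  degree_anti : ∀ u v, u ≤ v → (H.neighborSet v).ncard ≤ (H.neighborSet u).ncard
  height_mono : ∀ u v, u ≤ v → H.dist u r ≤ H.dist v r
  children_order : ∀ u x v y, H.Adj u v → ¬ H.Adj x v → H.Adj x y → ¬ H.Adj u y →
    H.dist u r = H.dist x r → H.dist v r = H.dist u r + 1 → H.dist y r = H.dist u r + 1 →
    u < x → v < y

/-- The graph `U_π^{(t)}`: `K_t ∨ C_{n-t}` if all entries of `π*` are `2`, and `K_t ∨ U_{π*}`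
otherwise. -/
def extremalConeUnicyclic {n : ℕ} (π : Fin n → ℕ) (t : ℕ) : SimpleGraph (Fin t ⊕ Fin (n - t)) :=
  open scoped Classical in
  if ∀ i, reducedSeq π t i = 2 then
    graphJoin (⊤ : SimpleGraph (Fin t)) (SimpleGraph.cycleGraph (n - t))
  else
    graphJoin (⊤ : SimpleGraph (Fin t)) (bfsUnicyclic (reducedSeq π t))

/-! The class is finite, so it has a maximal graph; it suffices to show that every maximal graph is
isomorphic to `extremalConeUnicyclic π t`. The converse follows because the spectral radius and
membership in the class are isomorphism invariants. If all reduced degrees are 2, the unicyclic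
factor is connected and 2-regular, hence a cycle.

Otherwise let K_t ∨ H be maximal, x its positive Perron vector and f the restriction of x to H.
Replacing H by a connected H' with the same degrees stays in the class, and the quadratic form of
the join at x changes exactly as the form of H at f does. If it does not decrease, the Rayleigh
principle makes x an eigenvector of the new join for the same eigenvalue, so H and H' act
identically on f (`IsPerronMax.rigid`). Hence no move is possible that keeps the form from
decreasing and changes the action at some vertex. Two moves are used. Moving neighbours from v to u
shows that degrees are ordered as the entries of f (`IsPerronMax.ncard_le`). Trading edges vw, zy
for vz, wy changes the form by 2(f v - f y)(f z - f w) (`IsPerronMax.not_switch`).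

Since the degrees average 2 and are not all 2, some degree is at least 3, so the vertex r with the
largest entry has such a degree. A tree of shortest paths to r misses exactly one edge ab. Edge
switches show that a and b are children of r, that entries do not increase from parent to child, and
that children are ordered as their parents (`par_left_eq_root`, `le_par`, `le_of_par_le`). So there
is a breadth-first numbering in which r, a, b come first, the parent map is monotone and degrees do
not increase (`exists_perm_layered`). Such a layered graph is determined by its degrees
(`IsLayeredUnicyclic.eq_bfsUnicyclic`), and its cycle and BFS properties can be read off the parent
map. -/

open Matrix

/-! ### Rayleigh principle and Perron vectors for A + αD. -/

section Perron

open scoped Classical in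
/-- The real adjacency indicator of a graph. -/
noncomputable def adjInd {V : Type*} (G : SimpleGraph V) (i j : V) : ℝ := if G.Adj i j then 1 else 0

theorem adjInd_nonneg {V : Type*} (G : SimpleGraph V) (i j : V) : 0 ≤ adjInd G i j := by
  unfold adjInd; split_ifs <;> norm_num

theorem adjInd_congr {V W : Type*} {G : SimpleGraph V} {G' : SimpleGraph W} {i j : V} {k l : W}
    (h : G.Adj i j ↔ G'.Adj k l) : adjInd G i j = adjInd G' k l := by
  classical exact if_congr h rfl rfl

variable {V : Type*} [Fintype V]

theorem sum_adjInd (G : SimpleGraph V) (i : V) :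
    ∑ j, adjInd G i j = ((G.neighborSet i).ncard : ℝ) := by
  classical
  rw [Set.ncard_eq_toFinset_card']
  simp only [adjInd, Finset.sum_boole]
  congr 2
  ext j; simp

/-- The action of `A(G) + α D(G)` on a vector. -/
noncomputable def genApply (α : ℝ) (G : SimpleGraph V) (x : V → ℝ) (i : V) : ℝ :=
  ∑ j, adjInd G i j * (x j + α * x i)

/-- The quadratic form of `A(G) + α D(G)`. -/
noncomputable def genForm (α : ℝ) (G : SimpleGraph V) (x : V → ℝ) : ℝ :=
  ∑ i, x i * genApply α G x i

theorem genApply_eq (α : ℝ) (G : SimpleGraph V) (x : V → ℝ) (i : V) :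
    genApply α G x i = ∑ j, adjInd G i j * x j + α * (G.neighborSet i).ncard * x i := by
  simp only [genApply, mul_add, Finset.sum_add_distrib, ← sum_adjInd, ← mul_assoc]
  rw [← Finset.sum_mul, ← Finset.sum_mul]
  ring

theorem generalMatrix_mulVec (α : ℝ) (G : SimpleGraph V) (x : V → ℝ) :
    generalMatrix α G *ᵥ x = genApply α G x := by
  classical
  ext i
  rw [genApply_eq, generalMatrix, Matrix.add_mulVec, Matrix.smul_mulVec]
  simp only [Pi.add_apply, Pi.smul_apply, smul_eq_mul]
  refine congrArg₂ _ ?_ ?_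
  · simp [Matrix.mulVec, dotProduct, adjInd]
  · have h : SimpleGraph.degMatrix ℝ G *ᵥ x = fun i => (G.degree i : ℝ) * x i := by
      ext i
      convert Matrix.mulVec_diagonal (fun i => (G.degree i : ℝ)) x i
      unfold SimpleGraph.degMatrix
      congr!
    rw [h]
    dsimp only
    rw [← SimpleGraph.card_neighborSet_eq_degree, Set.ncard_eq_toFinset_card',
      Set.toFinset_card, mul_assoc]

theorem genForm_eq (α : ℝ) (G : SimpleGraph V) (x : V → ℝ) :
    genForm α G x = ∑ i, ∑ j, adjInd G i j * (x i * x j + α * x i ^ 2) := by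
  simp only [genForm, genApply, Finset.mul_sum]
  refine Finset.sum_congr rfl fun i _ => Finset.sum_congr rfl fun j _ => by ring

theorem genForm_eq_dotProduct (α : ℝ) (G : SimpleGraph V) (x : V → ℝ) :
    genForm α G x = x ⬝ᵥ (generalMatrix α G *ᵥ x) := by
  classical
  rw [generalMatrix_mulVec]; rfl

theorem generalMatrix_isHermitian (α : ℝ) (G : SimpleGraph V) :
    (generalMatrix α G).IsHermitian := by
  classical
  unfold generalMatrix
  refine Matrix.IsHermitian.add ?_ ?_
  · rw [Matrix.IsHermitian, Matrix.conjTranspose_eq_transpose_of_trivial]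
    exact G.transpose_adjMatrix
  · rw [SimpleGraph.degMatrix]
    rw [Matrix.IsHermitian, Matrix.conjTranspose_eq_transpose_of_trivial]
    simp

theorem exists_max_genForm [Nonempty V] (α : ℝ) (G : SimpleGraph V) :
    ∃ x : V → ℝ, ∑ i, x i ^ 2 = 1 ∧ ∀ y : V → ℝ, genForm α G y ≤ genForm α G x * ∑ i, y i ^ 2 := by
  classical
  have hcont : Continuous (genForm α G) := by
    unfold genForm genApply; fun_prop
  let S : Set (V → ℝ) := {x | ∑ i, x i ^ 2 = 1}
  have hclosed : IsClosed S := isClosed_eq (by fun_prop) continuous_const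
  have hS : IsCompact S := by
    refine Metric.isCompact_of_isClosed_isBounded hclosed ?_
    refine (Metric.isBounded_closedBall (x := (0 : V → ℝ)) (r := 1)).subset fun x hx => ?_
    rw [mem_closedBall_zero_iff, pi_norm_le_iff_of_nonneg zero_le_one]
    intro i
    have : x i ^ 2 ≤ ∑ i, x i ^ 2 :=
      Finset.single_le_sum (f := fun i => x i ^ 2) (fun i _ => sq_nonneg _) (Finset.mem_univ i)
    rw [show ∑ i, x i ^ 2 = 1 from hx] at this
    rw [Real.norm_eq_abs]
    exact abs_le_one_iff_mul_self_le_one.2 (by nlinarith)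
  obtain ⟨v⟩ := ‹Nonempty V›
  have hne : S.Nonempty := ⟨Pi.single v 1, by simp [S, Pi.single_apply]⟩
  obtain ⟨x, hx, hmax⟩ := hS.exists_isMaxOn hne hcont.continuousOn
  refine ⟨x, hx, fun y => ?_⟩
  have hs : 0 ≤ ∑ i, y i ^ 2 := Finset.sum_nonneg fun i _ => sq_nonneg _
  rcases hs.eq_or_lt with h0 | hpos
  · have hy : y = 0 := by
      ext i
      have := (Finset.sum_eq_zero_iff_of_nonneg (fun i _ => sq_nonneg (y i))).1 h0.symm i
        (Finset.mem_univ i)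
      simpa using this
    subst hy
    simp [genForm]
  · set s := ∑ i, y i ^ 2 with hsdef
    set c := (Real.sqrt s)⁻¹ with hc
    have hc2 : c ^ 2 * s = 1 := by
      rw [hc, inv_pow, Real.sq_sqrt hs, inv_mul_cancel₀ hpos.ne']
    have hmem : (fun i => c * y i) ∈ S := by
      change ∑ i, (c * y i) ^ 2 = 1
      simp only [mul_pow]
      rw [← Finset.mul_sum, ← hsdef, hc2]
    have hle : genForm α G (fun i => c * y i) ≤ genForm α G x := hmax hmem
    have hscale : genForm α G (fun i => c * y i) = c ^ 2 * genForm α G y := by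
      rw [genForm_eq, genForm_eq]
      simp only [Finset.mul_sum]
      refine Finset.sum_congr rfl fun i _ => Finset.sum_congr rfl fun j _ => by ring
    rw [hscale] at hle
    calc genForm α G y = (c ^ 2 * genForm α G y) * s := by
          rw [mul_right_comm, hc2, one_mul]
      _ ≤ _ := mul_le_mul_of_nonneg_right hle hs

/-- The bound makes μI - (A + αD) positive semidefinite, and a vector at which a semidefinite form
vanishes lies in the kernel. -/
theorem genApply_eq_of_genForm_eq (α μ : ℝ) (G : SimpleGraph V)
    (hμ : ∀ y : V → ℝ, genForm α G y ≤ μ * ∑ i, y i ^ 2) (x : V → ℝ)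
    (hx : genForm α G x = μ * ∑ i, x i ^ 2) (i : V) : genApply α G x i = μ * x i := by
  classical
  have hform (y : V → ℝ) : y ⬝ᵥ ((μ • (1 : Matrix V V ℝ) - generalMatrix α G) *ᵥ y) =
      μ * ∑ i, y i ^ 2 - genForm α G y := by
    rw [Matrix.sub_mulVec, dotProduct_sub, genForm_eq_dotProduct, Matrix.smul_mulVec,
      Matrix.one_mulVec, dotProduct_smul]
    simp [dotProduct, sq]
  have hS : (μ • (1 : Matrix V V ℝ) - generalMatrix α G).PosSemidef := by
    refine Matrix.PosSemidef.of_dotProduct_mulVec_nonneg ?_ fun y => ?_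
    · refine Matrix.IsHermitian.sub ?_ (generalMatrix_isHermitian α G)
      rw [Matrix.IsHermitian, Matrix.conjTranspose_eq_transpose_of_trivial]
      simp
    · rw [star_trivial, hform]
      exact sub_nonneg.2 (hμ y)
  have h0 := (hS.dotProduct_mulVec_zero_iff x).1 (by rw [star_trivial, hform, hx, sub_self])
  have := congrFun h0 i
  rw [Matrix.sub_mulVec, Matrix.smul_mulVec, Matrix.one_mulVec, generalMatrix_mulVec] at this
  simp at this
  linarith

theorem generalSpectralRadius_eq [Nonempty V] (α : ℝ) (G : SimpleGraph V) (x : V → ℝ)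
    (hx : ∑ i, x i ^ 2 = 1) (hmax : ∀ y : V → ℝ, genForm α G y ≤ genForm α G x * ∑ i, y i ^ 2) :
    generalSpectralRadius G α = genForm α G x := by
  classical
  have hev := genApply_eq_of_genForm_eq α _ G hmax x (by rw [hx, mul_one])
  unfold generalSpectralRadius
  apply IsGreatest.csSup_eq
  constructor
  · refine Module.End.hasEigenvalue_of_hasEigenvector (x := x) ⟨?_, ?_⟩
    · rw [Module.End.mem_eigenspace_iff]
      ext i
      rw [Matrix.toLin'_apply]
      rw [generalMatrix_mulVec]
      exact hev i
    · rintro rfl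
      simp at hx
  · rintro ν hν
    obtain ⟨y, hy⟩ := hν.exists_hasEigenvector
    have h1 := hy.apply_eq_smul
    have h2 : genForm α G y = ν * ∑ i, y i ^ 2 := by
      rw [genForm_eq_dotProduct]
      rw [Matrix.toLin'_apply] at h1
      rw [h1, dotProduct_smul]
      simp [dotProduct, sq]
    have h3 := hmax y
    have hpos : 0 < ∑ i, y i ^ 2 := by
      obtain ⟨i, hi⟩ := Function.ne_iff.1 hy.2
      exact Finset.sum_pos' (fun i _ => sq_nonneg _)
        ⟨i, Finset.mem_univ i, lt_of_le_of_ne (sq_nonneg _) (Ne.symm (pow_ne_zero 2 hi))⟩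
    rw [h2] at h3
    exact le_of_mul_le_mul_right h3 hpos

theorem genForm_le [Nonempty V] (α : ℝ) (G : SimpleGraph V) (y : V → ℝ) :
    genForm α G y ≤ generalSpectralRadius G α * ∑ i, y i ^ 2 := by
  obtain ⟨x, hx, hmax⟩ := exists_max_genForm α G
  rw [generalSpectralRadius_eq α G x hx hmax]
  exact hmax y

/-- A connected graph has a positive eigenvector for its general spectral radius. -/
theorem exists_perron [Nonempty V] (α : ℝ) (G : SimpleGraph V) (hG : G.Connected) :
    ∃ x : V → ℝ, (∀ i, 0 < x i) ∧ (∀ i, genApply α G x i = generalSpectralRadius G α * x i) := by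
  classical
  obtain ⟨x, hx, hmax⟩ := exists_max_genForm α G
  set μ := generalSpectralRadius G α
  have hμ : μ = genForm α G x := generalSpectralRadius_eq α G x hx hmax
  have hle := genForm_le α G
  have habs : ∑ i, |x i| ^ 2 = 1 := by simpa using hx
  -- The adjacency entries are nonnegative, so passing to absolute values does not lower the form:
  -- |x| is a maximiser too, hence an eigenvector.
  have hev := genApply_eq_of_genForm_eq α μ G hle (fun i => |x i|) (by
    apply le_antisymm (hle _)
    rw [habs, mul_one, show generalSpectralRadius G α = _ from hμ, genForm_eq, genForm_eq]
    refine Finset.sum_le_sum fun i _ => Finset.sum_le_sum fun j _ => ?_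
    refine mul_le_mul_of_nonneg_left ?_ (adjInd_nonneg G i j)
    rw [sq_abs, ← abs_mul]
    linarith [le_abs_self (x i * x j)])
  refine ⟨fun i => |x i|, ?_, hev⟩
  -- At a zero entry the eigenvalue equation says that the nonnegative neighbouring entries sum to
  -- zero; connectedness then spreads the zero everywhere.
  have hstep : ∀ i j, G.Adj i j → |x i| = 0 → |x j| = 0 := by
    intro i j hij hi
    have h := hev i
    rw [genApply] at h
    simp only [hi, mul_zero, add_zero] at h
    have := (Finset.sum_eq_zero_iff_of_nonneg
      (fun j _ => mul_nonneg (adjInd_nonneg G i j) (abs_nonneg (x j)))).1 h j (Finset.mem_univ j)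
    simpa [adjInd, hij] using this
  intro i
  by_contra hi
  have hi0 : |x i| = 0 := le_antisymm (not_lt.1 hi) (abs_nonneg _)
  have hall : ∀ j, |x j| = 0 := by
    intro j
    obtain ⟨w⟩ := hG.preconnected i j
    induction w with
    | nil => exact hi0
    | cons hadj _ ih => exact ih (by have := hstep _ _ hadj hi0; simp [this]) (hstep _ _ hadj hi0)
  simp [hall] at habs

theorem generalSpectralRadius_iso {W : Type*} [Fintype W] [Nonempty V] (α : ℝ)
    {G : SimpleGraph V} {G' : SimpleGraph W} (e : G ≃g G') :
    generalSpectralRadius G α = generalSpectralRadius G' α := by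
  have : Nonempty W := e.toEquiv.nonempty_congr.1 ‹_›
  have hform (y : W → ℝ) : genForm α G (y ∘ e) = genForm α G' y := by
    rw [genForm_eq, genForm_eq, ← e.toEquiv.sum_comp]
    refine Finset.sum_congr rfl fun i _ => ?_
    rw [← e.toEquiv.sum_comp]
    refine Finset.sum_congr rfl fun j _ => ?_
    have h : G'.Adj (e.toEquiv i) (e.toEquiv j) ↔ G.Adj i j := e.map_adj_iff
    have h' : adjInd G' (e.toEquiv i) (e.toEquiv j) = adjInd G i j := adjInd_congr h
    rw [h']
    rfl
  have hsum (y : W → ℝ) : ∑ i, (y ∘ e) i ^ 2 = ∑ i, y i ^ 2 :=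
    e.toEquiv.sum_comp (fun i => y i ^ 2)
  obtain ⟨x, hx, hmax⟩ := exists_max_genForm α G'
  rw [generalSpectralRadius_eq α G' x hx hmax, ← hform x]
  refine generalSpectralRadius_eq α G _ (by rw [hsum, hx]) fun y => ?_
  have := hmax (y ∘ e.symm)
  rw [← hform, ← hsum, ← hform] at this
  have hy : (y ∘ e.symm) ∘ e = y := by ext; simp
  rwa [hy] at this

end Perron

/-! ### Degrees and quadratic forms of joins. -/

section Join

theorem sum_ncard_neighborSet {V : Type*} [Fintype V] (H : SimpleGraph V) :
    ∑ i, (H.neighborSet i).ncard = 2 * Nat.card H.edgeSet := by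
  classical
  rw [Nat.card_eq_fintype_card, ← SimpleGraph.edgeFinset_card,
    ← SimpleGraph.sum_degrees_eq_twice_card_edges]
  refine Finset.sum_congr rfl fun i _ => ?_
  rw [← SimpleGraph.card_neighborSet_eq_degree, Set.ncard_eq_toFinset_card', Set.toFinset_card]

theorem ncard_neighborSet_iso {V W : Type*} {G : SimpleGraph V} {G' : SimpleGraph W}
    (e : G ≃g G') (v : V) : (G'.neighborSet (e v)).ncard = (G.neighborSet v).ncard := by
  have h : G'.neighborSet (e v) = e '' G.neighborSet v := by
    ext w
    obtain ⟨u, rfl⟩ := e.surjective w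
    simp only [SimpleGraph.mem_neighborSet, e.injective.mem_set_image]
    exact e.map_adj_iff
  rw [h, Set.ncard_image_of_injective _ e.injective]

/-- The degrees of `H'` are a rearrangement of those of `H`. -/
def SameDegrees {V : Type*} (H H' : SimpleGraph V) : Prop :=
  ∃ σ : Equiv.Perm V, ∀ i, (H'.neighborSet (σ i)).ncard = (H.neighborSet i).ncard

theorem SameDegrees.card_edgeSet_eq {V : Type*} [Fintype V] {H H' : SimpleGraph V}
    (h : SameDegrees H H') : Nat.card H'.edgeSet = Nat.card H.edgeSet := by
  obtain ⟨σ, hσ⟩ := h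
  have h1 := sum_ncard_neighborSet H
  have h2 := sum_ncard_neighborSet H'
  rw [← Equiv.sum_comp σ, Finset.sum_congr rfl fun i _ => hσ i] at h2
  omega

variable {V W : Type*}

@[simp] theorem graphJoin_adj_inl_inl (G : SimpleGraph V) (H : SimpleGraph W) (u v : V) :
    (graphJoin G H).Adj (Sum.inl u) (Sum.inl v) ↔ G.Adj u v := by simp [graphJoin]

@[simp] theorem graphJoin_adj_inr_inr (G : SimpleGraph V) (H : SimpleGraph W) (u v : W) :
    (graphJoin G H).Adj (Sum.inr u) (Sum.inr v) ↔ H.Adj u v := by simp [graphJoin]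

@[simp] theorem graphJoin_adj_inl_inr (G : SimpleGraph V) (H : SimpleGraph W) (u : V) (v : W) :
    (graphJoin G H).Adj (Sum.inl u) (Sum.inr v) := by simp [graphJoin]

@[simp] theorem graphJoin_adj_inr_inl (G : SimpleGraph V) (H : SimpleGraph W) (u : W) (v : V) :
    (graphJoin G H).Adj (Sum.inr u) (Sum.inl v) := by simp [graphJoin]

/-- Isomorphic second factors give isomorphic joins. -/
def graphJoinCongr (G : SimpleGraph V) {W' : Type*} {H : SimpleGraph W} {H' : SimpleGraph W'}
    (e : H ≃g H') : graphJoin G H ≃g graphJoin G H' where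
  toEquiv := Equiv.sumCongr (Equiv.refl V) e.toEquiv
  map_rel_iff' := by
    rintro (u | u) (v | v)
    · simp
    · simp
    · simp
    · simpa using e.map_adj_iff

theorem graphJoin_connected [Nonempty W] (G : SimpleGraph V) {H : SimpleGraph W}
    (hH : H.Connected) : (graphJoin G H).Connected := by
  obtain ⟨w⟩ := ‹Nonempty W›
  have key : ∀ x, (graphJoin G H).Reachable x (Sum.inr w) := by
    rintro (u | u)
    · exact (graphJoin_adj_inl_inr G H u w).reachable
    · let φ : H →g graphJoin G H := ⟨Sum.inr, fun h => (graphJoin_adj_inr_inr G H _ _).2 h⟩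
      exact (hH.preconnected u w).map φ
  have : Nonempty (V ⊕ W) := ⟨Sum.inr w⟩
  exact ⟨fun x y => (key x).trans (key y).symm⟩

@[simp] theorem adjInd_graphJoin_inl_inl (G : SimpleGraph V) (H : SimpleGraph W) (u v : V) :
    adjInd (graphJoin G H) (Sum.inl u) (Sum.inl v) = adjInd G u v :=
  adjInd_congr (graphJoin_adj_inl_inl G H u v)

@[simp] theorem adjInd_graphJoin_inr_inr (G : SimpleGraph V) (H : SimpleGraph W) (u v : W) :
    adjInd (graphJoin G H) (Sum.inr u) (Sum.inr v) = adjInd H u v :=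
  adjInd_congr (graphJoin_adj_inr_inr G H u v)

@[simp] theorem adjInd_graphJoin_inl_inr (G : SimpleGraph V) (H : SimpleGraph W) (u : V) (v : W) :
    adjInd (graphJoin G H) (Sum.inl u) (Sum.inr v) = 1 :=
  if_pos (graphJoin_adj_inl_inr G H u v)

@[simp] theorem adjInd_graphJoin_inr_inl (G : SimpleGraph V) (H : SimpleGraph W) (u : W) (v : V) :
    adjInd (graphJoin G H) (Sum.inr u) (Sum.inl v) = 1 :=
  if_pos (graphJoin_adj_inr_inl G H u v)

variable [Fintype V] [Fintype W]

theorem ncard_neighborSet_graphJoin_inr (G : SimpleGraph V) (H : SimpleGraph W) (v : W) :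
    ((graphJoin G H).neighborSet (Sum.inr v)).ncard =
      Fintype.card V + (H.neighborSet v).ncard := by
  have h := sum_adjInd (graphJoin G H) (Sum.inr v)
  rw [Fintype.sum_sum_type] at h
  simp [sum_adjInd] at h
  exact_mod_cast h.symm

theorem ncard_neighborSet_graphJoin_inl (G : SimpleGraph V) (H : SimpleGraph W) (v : V) :
    ((graphJoin G H).neighborSet (Sum.inl v)).ncard =
      (G.neighborSet v).ncard + Fintype.card W := by
  have h := sum_adjInd (graphJoin G H) (Sum.inl v)
  rw [Fintype.sum_sum_type] at h
  simp [sum_adjInd] at h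
  exact_mod_cast h.symm

theorem genApply_graphJoin_inr (α : ℝ) (G : SimpleGraph V) (H : SimpleGraph W) (x : V ⊕ W → ℝ)
    (v : W) : genApply α (graphJoin G H) x (Sum.inr v) =
      ∑ u, (x (Sum.inl u) + α * x (Sum.inr v)) + genApply α H (x ∘ Sum.inr) v := by
  simp [genApply, Fintype.sum_sum_type]

/-- The second factor enters only through its own diagonal block, so forms of joins with different
second factors can be compared on that block alone. -/
theorem genForm_graphJoin (α : ℝ) (G : SimpleGraph V) (x : V ⊕ W → ℝ) :
    ∃ c, ∀ H : SimpleGraph W,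
      genForm α (graphJoin G H) x = c + genForm α H (x ∘ Sum.inr) := by
  refine ⟨∑ u, x (Sum.inl u) * genApply α (graphJoin G (⊥ : SimpleGraph W)) x (Sum.inl u) +
    ∑ v : W, x (Sum.inr v) * ∑ u, (x (Sum.inl u) + α * x (Sum.inr v)), fun H => ?_⟩
  rw [genForm, Fintype.sum_sum_type, add_assoc]
  congr 1
  · simp [genApply, Fintype.sum_sum_type]
  · rw [genForm, ← Finset.sum_add_distrib]
    refine Finset.sum_congr rfl fun v _ => ?_
    rw [genApply_graphJoin_inr, mul_add]
    rfl

/-- The restriction `f` of a Perron vector to a graph `H` that is extremal among the connected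
graphs with the same degrees: no such graph has a larger form at `f`, and those with the same
value act on `f` in the same way. -/
structure IsPerronMax {V : Type*} [Fintype V] (α : ℝ) (H : SimpleGraph V) (f : V → ℝ) : Prop where
  connected : H.Connected
  pos : ∀ v, 0 < f v
  rigid : ∀ H' : SimpleGraph V, H'.Connected → SameDegrees H H' →
    genForm α H f ≤ genForm α H' f → ∀ v, genApply α H' f v = genApply α H f v

/-- If H' does at least as well as H at f, then x attains the bound μ|x|² for the join with H' as
well. So x is an eigenvector of both joins for μ, and the contribution of G to the rows of W
cancels. -/
theorem exists_isPerronMax (α : ℝ) (G : SimpleGraph V) (H : SimpleGraph W) (hH : H.Connected)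
    (hmax : ∀ H' : SimpleGraph W, H'.Connected → SameDegrees H H' →
      generalSpectralRadius (graphJoin G H') α ≤ generalSpectralRadius (graphJoin G H) α) :
    ∃ f : W → ℝ, IsPerronMax α H f := by
  have := hH.nonempty
  obtain ⟨x, hx, hev⟩ := exists_perron α _ (graphJoin_connected G hH)
  refine ⟨x ∘ Sum.inr, hH, fun v => hx _, fun H' hc hd hle v => ?_⟩
  set μ := generalSpectralRadius (graphJoin G H) α
  have hQ : genForm α (graphJoin G H) x = μ * ∑ i, x i ^ 2 := by
    rw [genForm, Finset.mul_sum]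
    refine Finset.sum_congr rfl fun i _ => ?_
    rw [hev]; ring
  obtain ⟨c, hcc⟩ := genForm_graphJoin α G x
  have hQ' : μ * ∑ i, x i ^ 2 ≤ genForm α (graphJoin G H') x := by
    rw [← hQ, hcc, hcc]; linarith
  have hμ : ∀ y, genForm α (graphJoin G H') y ≤ μ * ∑ i, y i ^ 2 := fun y =>
    (genForm_le α _ y).trans (mul_le_mul_of_nonneg_right (hmax H' hc hd)
      (Finset.sum_nonneg fun i _ => sq_nonneg _))
  have h1 := genApply_eq_of_genForm_eq α μ _ hμ x (le_antisymm (hμ x) hQ') (Sum.inr v)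
  rw [← hev (Sum.inr v), genApply_graphJoin_inr, genApply_graphJoin_inr] at h1
  exact add_left_cancel h1

end Join

/-! ### Degree sequences and competitors inside the class. -/

section ConeClass

theorem eq_of_antitone_of_perm {m : ℕ} {β : Type*} [PartialOrder β] {f g : Fin m → β}
    (hf : Antitone f) (hg : Antitone g) (e : Equiv.Perm (Fin m)) (h : ∀ i, f (e i) = g i) :
    f = g := by
  have h1 : f ∘ e = g := funext h
  have := Tuple.unique_antitone (f := f) (σ := Equiv.refl _) (τ := e) (by simpa using hf)
    (by rw [h1]; exact hg)
  rw [h1] at this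
  simpa using this

theorem exists_antitone_sort {m : ℕ} (g : Fin m → ℕ) :
    ∃ σ : Equiv.Perm (Fin m), Antitone (g ∘ σ) := by
  refine ⟨Fin.revPerm.trans (Tuple.sort g), fun i j hij => ?_⟩
  exact Tuple.monotone_sort g (by simpa using hij)

theorem ncard_neighborSet_lt {V : Type*} [Fintype V] (H : SimpleGraph V) (v : V) :
    (H.neighborSet v).ncard + 1 ≤ Fintype.card V := by
  classical
  have h : (H.neighborSet v).ncard < (Set.univ : Set V).ncard := by
    apply Set.ncard_lt_ncard _ Set.finite_univ
    refine ⟨Set.subset_univ _, fun h => ?_⟩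
    exact H.irrefl (h (Set.mem_univ v))
  rw [Set.ncard_univ, Nat.card_eq_fintype_card] at h
  omega

theorem ncard_neighborSet_top {t : ℕ} (u : Fin t) :
    ((⊤ : SimpleGraph (Fin t)).neighborSet u).ncard = t - 1 := by
  rw [SimpleGraph.neighborSet_top, Set.ncard_compl, Set.ncard_singleton]
  simp

/-- The degrees of the unicyclic part of a graph of the class are the entries of `π*`. -/
theorem exists_perm_reducedSeq {n t : ℕ} (ht : t ≤ n) {π : Fin n → ℕ} (hπ : Antitone π)
    (G : SimpleGraph (Fin n)) (hG : HasDegreeSequence G π) (H : SimpleGraph (Fin (n - t)))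
    (e : G ≃g graphJoin (⊤ : SimpleGraph (Fin t)) H) :
    Antitone (reducedSeq π t) ∧
    ∃ σ : Equiv.Perm (Fin (n - t)), ∀ i, (H.neighborSet (σ i)).ncard = reducedSeq π t i := by
  obtain ⟨σ, hσ⟩ := exists_antitone_sort fun i => (H.neighborSet i).ncard
  obtain ⟨e₀, he₀⟩ := hG
  let c : Fin t ⊕ Fin (n - t) ≃ Fin n := finSumFinEquiv.trans (finCongr (by omega))
  -- Vertices of K_t have the largest possible degree n - 1, so they may be listed first. This list
  -- is then non-increasing and must equal π, whose tail gives the degrees of H.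
  let ρ : Fin t ⊕ Fin (n - t) → ℕ :=
    Sum.elim (fun _ => n - 1) (fun i => t + (H.neighborSet (σ i)).ncard)
  have hρ : ∀ s, ((graphJoin (⊤ : SimpleGraph (Fin t)) H).neighborSet
      (Equiv.sumCongr (Equiv.refl _) σ s)).ncard = ρ s := by
    rintro (u | u)
    · have := u.isLt
      simp only [Equiv.sumCongr_apply, Sum.map_inl, ρ, Sum.elim_inl,
        ncard_neighborSet_graphJoin_inl, ncard_neighborSet_top, Fintype.card_fin]
      omega
    · simp only [Equiv.sumCongr_apply, Sum.map_inr, ρ, Sum.elim_inr,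
        ncard_neighborSet_graphJoin_inr, Fintype.card_fin]
  have hanti : Antitone (ρ ∘ c.symm) := by
    intro i j hij
    obtain ⟨i, rfl⟩ := c.surjective i
    obtain ⟨j, rfl⟩ := c.surjective j
    have hb (k) : t + (H.neighborSet (σ k)).ncard ≤ n - 1 := by
      have := ncard_neighborSet_lt H (σ k)
      rw [Fintype.card_fin] at this
      omega
    rcases i with i | i <;> rcases j with j | j <;>
      simp only [Function.comp_apply, Equiv.symm_apply_apply, ρ, Sum.elim_inl, Sum.elim_inr]
    · exact le_rfl
    · exact hb j
    · exfalso
      have := i.isLt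
      have hj := j.isLt
      rw [Fin.le_def] at hij
      simp [c] at hij
      omega
    · have : i ≤ j := by
        rw [Fin.le_def] at hij
        simpa [c] using hij
      exact Nat.add_le_add_left (hσ this) t
  have heq : π = ρ ∘ c.symm := by
    refine eq_of_antitone_of_perm hπ hanti
      (c.symm.trans ((Equiv.sumCongr (Equiv.refl _) σ).trans (e.toEquiv.symm.trans e₀.symm)))
      fun i => ?_
    simp only [Function.comp_apply]
    rw [← he₀, ← hρ, ← ncard_neighborSet_iso e]
    simp only [Equiv.trans_apply, Equiv.apply_symm_apply]
    congr 2
    exact e.toEquiv.apply_symm_apply _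
  have hred : ∀ i, reducedSeq π t i = (H.neighborSet (σ i)).ncard := by
    intro i
    have hi : (⟨t + i.val, by omega⟩ : Fin n) = c (Sum.inr i) := by
      ext; simp [c]
    rw [reducedSeq, hi, heq]
    simp [ρ]
  refine ⟨fun i j hij => ?_, σ, fun i => (hred i).symm⟩
  rw [hred, hred]
  exact hσ hij

theorem HasDegreeSequence.of_iso {V W : Type*} {m : ℕ} {d : Fin m → ℕ} {G : SimpleGraph V}
    {G' : SimpleGraph W} (h : HasDegreeSequence G d) (e : G ≃g G') : HasDegreeSequence G' d := by
  obtain ⟨e₀, he₀⟩ := h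
  refine ⟨e₀.trans e.toEquiv, fun i => ?_⟩
  rw [← he₀]
  exact ncard_neighborSet_iso e (e₀ i)

theorem HasDegreeSequence.graphJoin {t m n : ℕ} {d : Fin n → ℕ} {H H' : SimpleGraph (Fin m)}
    (h : HasDegreeSequence (graphJoin (⊤ : SimpleGraph (Fin t)) H) d) (hs : SameDegrees H H') :
    HasDegreeSequence (graphJoin (⊤ : SimpleGraph (Fin t)) H') d := by
  obtain ⟨e₀, he₀⟩ := h
  obtain ⟨σ, hσ⟩ := hs
  refine ⟨e₀.trans (Equiv.sumCongr (Equiv.refl _) σ), fun i => ?_⟩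
  rw [← he₀]
  simp only [Equiv.trans_apply]
  rcases e₀ i with u | u
  · simp [ncard_neighborSet_graphJoin_inl]
  · simp [ncard_neighborSet_graphJoin_inr, hσ]

theorem mem_coneClass_of_iso {n t c : ℕ} {π : Fin n → ℕ} {G G' : SimpleGraph (Fin n)}
    (h : G ∈ coneClass π t c) (e : G ≃g G') : G' ∈ coneClass π t c := by
  obtain ⟨hd, H, hH, ⟨e'⟩⟩ := h
  exact ⟨hd.of_iso e, H, hH, ⟨e.symm.trans e'⟩⟩

theorem exists_isPerronMax_of_isThetaMaximal {α : ℝ} {n t c : ℕ} (ht : t < n) {π : Fin n → ℕ}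
    {G : SimpleGraph (Fin n)} (hG : IsThetaMaximal α (coneClass π t c) G)
    {H : SimpleGraph (Fin (n - t))} (hH : IsCyclicOfRank c H)
    (e : G ≃g graphJoin (⊤ : SimpleGraph (Fin t)) H) :
    ∃ f, IsPerronMax α H f := by
  refine exists_isPerronMax α (⊤ : SimpleGraph (Fin t)) H hH.1 fun H' hc hs => ?_
  have : Nonempty (Fin n) := ⟨⟨0, by omega⟩⟩
  -- The competing join has to be carried over to `Fin n` before maximality applies to it.
  let q : Fin t ⊕ Fin (n - t) ≃ Fin n := finSumFinEquiv.trans (finCongr (by omega))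
  let e' : graphJoin (⊤ : SimpleGraph (Fin t)) H' ≃g
      (graphJoin (⊤ : SimpleGraph (Fin t)) H').map q := SimpleGraph.Iso.map q _
  rw [← generalSpectralRadius_iso α e, ← generalSpectralRadius_iso α e'.symm]
  refine hG.2 _ ⟨((hG.1.1.of_iso e).graphJoin hs).of_iso e', H', ⟨hc, ?_⟩, ⟨e'.symm⟩⟩
  rw [hs.card_edgeSet_eq]
  exact hH.2

end ConeClass

/-! ### Edge moves that preserve connectedness and the degree multiset. -/

section EdgeMoves

variable {V : Type*}

theorem connected_of_adj_reachable {H H' : SimpleGraph V} (hH : H.Connected)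
    (h : ∀ i j, H.Adj i j → H'.Reachable i j) : H'.Connected := by
  have := hH.nonempty
  refine ⟨fun x y => ?_⟩
  obtain ⟨p⟩ := hH.preconnected x y
  induction p with
  | nil => exact SimpleGraph.Reachable.refl _
  | cons hadj _ ih => exact (h _ _ hadj).trans ih

theorem deleteEdges_sup_edge {H : SimpleGraph V} {a b : V} (h : H.Adj a b) :
    H.deleteEdges {s(a, b)} ⊔ SimpleGraph.edge a b = H := by
  ext i j
  simp only [SimpleGraph.sup_adj, SimpleGraph.deleteEdges_adj, SimpleGraph.edge_adj,
    Set.mem_singleton_iff, Sym2.eq_iff]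
  constructor
  · rintro (h' | ⟨⟨rfl, rfl⟩ | ⟨rfl, rfl⟩, -⟩)
    · exact h'.1
    · exact h
    · exact h.symm
  · intro h'
    by_cases hc : i = a ∧ j = b ∨ i = b ∧ j = a
    · exact Or.inr ⟨hc, h'.ne⟩
    · exact Or.inl ⟨h', hc⟩

theorem not_adj_deleteEdges (H : SimpleGraph V) (a b : V) :
    ¬ (H.deleteEdges {s(a, b)}).Adj a b := by simp

open scoped Classical in
theorem adjInd_sup_edge {H : SimpleGraph V} {a b : V} (hab : a ≠ b) (h : ¬ H.Adj a b) (i j : V) :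
    adjInd (H ⊔ SimpleGraph.edge a b) i j = adjInd H i j + (if i = a then if j = b then 1 else 0
      else 0) + (if i = b then if j = a then 1 else 0 else 0) := by
  have h' : ¬ H.Adj b a := fun hh => h hh.symm
  by_cases hia : i = a
  · subst hia
    by_cases hjb : j = b
    · subst hjb
      simp [adjInd, SimpleGraph.edge_adj, h, hab]
    · simp [adjInd, SimpleGraph.edge_adj, hab, hjb]
  · by_cases hib : i = b
    · subst hib
      by_cases hja : j = a
      · subst hja
        simp [adjInd, SimpleGraph.edge_adj, h', hab.symm]
      · simp [adjInd, SimpleGraph.edge_adj, hia, hja]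
    · simp [adjInd, SimpleGraph.edge_adj, hia, hib]

variable [Fintype V]

open scoped Classical in
theorem ncard_neighborSet_sup_edge {H : SimpleGraph V} {a b : V} (hab : a ≠ b) (h : ¬ H.Adj a b)
    (i : V) : ((H ⊔ SimpleGraph.edge a b).neighborSet i).ncard =
      (H.neighborSet i).ncard + (if i = a then 1 else 0) + (if i = b then 1 else 0) := by
  have hs := sum_adjInd (H ⊔ SimpleGraph.edge a b) i
  simp only [adjInd_sup_edge hab h, Finset.sum_add_distrib, sum_adjInd] at hs
  have : (((H ⊔ SimpleGraph.edge a b).neighborSet i).ncard : ℝ) =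
      (H.neighborSet i).ncard + (if i = a then 1 else 0) + (if i = b then 1 else 0) := by
    rw [← hs]
    split_ifs <;> simp
  exact_mod_cast this

open scoped Classical in
theorem genApply_sup_edge {H : SimpleGraph V} {a b : V} (hab : a ≠ b) (h : ¬ H.Adj a b)
    (α : ℝ) (f : V → ℝ) (i : V) : genApply α (H ⊔ SimpleGraph.edge a b) f i =
      genApply α H f i + (if i = a then f b + α * f a else 0) +
        (if i = b then f a + α * f b else 0) := by
  simp only [genApply, adjInd_sup_edge hab h, add_mul, Finset.sum_add_distrib]
  congr 1
  · congr 1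
    split_ifs with h1 <;> simp [h1]
  · split_ifs with h1 <;> simp [h1]

theorem genForm_sup_edge {H : SimpleGraph V} {a b : V} (hab : a ≠ b) (h : ¬ H.Adj a b)
    (α : ℝ) (f : V → ℝ) : genForm α (H ⊔ SimpleGraph.edge a b) f =
      genForm α H f + 2 * f a * f b + α * (f a ^ 2 + f b ^ 2) := by
  classical
  simp only [genForm, genApply_sup_edge hab h, mul_add, Finset.sum_add_distrib]
  simp
  ring

/-- The graph `H` with the edges `vw`, `zy` replaced by `vz`, `wy`. -/
def edgeSwitch (H : SimpleGraph V) (v w z y : V) : SimpleGraph V :=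
  ((H.deleteEdges {s(v, w)}).deleteEdges {s(z, y)} ⊔ SimpleGraph.edge v z) ⊔ SimpleGraph.edge w y

/-- In an extremal graph the edges `vw`, `zy` cannot be switched to `vz`, `wy` with strict gain. -/
theorem IsPerronMax.not_switch {α : ℝ} {H : SimpleGraph V} {f : V → ℝ} (hf : IsPerronMax α H f)
    {v w z y : V} (hvw : H.Adj v w) (hzy : H.Adj z y) (hvz : v ≠ z) (hwy : w ≠ y)
    (hvz' : ¬ H.Adj v z) (hwy' : ¬ H.Adj w y)
    (hconn : ((H.deleteEdges {s(v, w)}).deleteEdges {s(z, y)}).Reachable v w ∨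
      ((H.deleteEdges {s(v, w)}).deleteEdges {s(z, y)}).Reachable v y ∨
      ((H.deleteEdges {s(v, w)}).deleteEdges {s(z, y)}).Reachable z w ∨
      ((H.deleteEdges {s(v, w)}).deleteEdges {s(z, y)}).Reachable z y)
    (h1 : f y ≤ f v) (h2 : f w < f z) : False := by
  classical
  set K := (H.deleteEdges {s(v, w)}).deleteEdges {s(z, y)} with hK
  have hvy : v ≠ y := by rintro rfl; exact hvz' hzy.symm
  have hwz : w ≠ z := by rintro rfl; exact hvz' hvw
  have hzy1 : (H.deleteEdges {s(v, w)}).Adj z y := by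
    rw [SimpleGraph.deleteEdges_adj]
    refine ⟨hzy, ?_⟩
    rw [Set.mem_singleton_iff, Sym2.eq_iff]
    rintro (⟨rfl, -⟩ | ⟨rfl, -⟩)
    · exact hvz rfl
    · exact hwz rfl
  have hK1 : K ⊔ SimpleGraph.edge z y = H.deleteEdges {s(v, w)} := deleteEdges_sup_edge hzy1
  have hK2 := deleteEdges_sup_edge hvw
  have hKzy : ¬ K.Adj z y := not_adj_deleteEdges _ _ _
  have hKvz : ¬ K.Adj v z := fun h => hvz' (by
    rw [hK, SimpleGraph.deleteEdges_adj, SimpleGraph.deleteEdges_adj] at h; exact h.1.1)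
  have hKwy : ¬ (K ⊔ SimpleGraph.edge v z).Adj w y := by
    rw [SimpleGraph.sup_adj, SimpleGraph.edge_adj]
    rintro (h | ⟨⟨rfl, -⟩ | ⟨rfl, -⟩, -⟩)
    · rw [hK, SimpleGraph.deleteEdges_adj, SimpleGraph.deleteEdges_adj] at h
      exact hwy' h.1.1
    · exact hvw.ne rfl
    · exact hwz rfl
  have hH' : edgeSwitch H v w z y = (K ⊔ SimpleGraph.edge v z) ⊔ SimpleGraph.edge w y := rfl
  have hvz2 : (edgeSwitch H v w z y).Adj v z := by
    rw [hH']; simp [SimpleGraph.edge_adj, hvz]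
  have hwy2 : (edgeSwitch H v w z y).Adj w y := by
    rw [hH']; simp [SimpleGraph.edge_adj, hwy]
  have hKle : K ≤ edgeSwitch H v w z y := by
    rw [hH', sup_assoc]; exact le_sup_left
  -- The new edges tie v to z and w to y, so one surviving path from {v, z} to {w, y} connects all
  -- four ends.
  have hvw2 : (edgeSwitch H v w z y).Reachable v w := by
    rcases hconn with h | h | h | h
    · exact h.mono hKle
    · exact (h.mono hKle).trans hwy2.symm.reachable
    · exact hvz2.reachable.trans (h.mono hKle)
    · exact hvz2.reachable.trans ((h.mono hKle).trans hwy2.symm.reachable)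
  have hzy2 : (edgeSwitch H v w z y).Reachable z y :=
    hvz2.symm.reachable.trans (hvw2.trans hwy2.reachable)
  have hc : (edgeSwitch H v w z y).Connected := by
    refine connected_of_adj_reachable hf.connected fun i j hij => ?_
    by_cases hi : s(i, j) = s(v, w)
    · rcases Sym2.eq_iff.1 hi with ⟨rfl, rfl⟩ | ⟨rfl, rfl⟩
      · exact hvw2
      · exact hvw2.symm
    by_cases hj : s(i, j) = s(z, y)
    · rcases Sym2.eq_iff.1 hj with ⟨rfl, rfl⟩ | ⟨rfl, rfl⟩
      · exact hzy2
      · exact hzy2.symm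
    refine (SimpleGraph.Adj.reachable ?_).mono hKle
    rw [hK, SimpleGraph.deleteEdges_adj, SimpleGraph.deleteEdges_adj]
    exact ⟨⟨hij, hi⟩, hj⟩
  have hd : SameDegrees H (edgeSwitch H v w z y) := by
    refine ⟨Equiv.refl _, fun i => ?_⟩
    have e1 := ncard_neighborSet_sup_edge hzy.ne hKzy i
    have e2 := ncard_neighborSet_sup_edge hvw.ne (not_adj_deleteEdges H v w) i
    rw [hK1] at e1
    rw [hK2] at e2
    rw [Equiv.refl_apply, hH', ncard_neighborSet_sup_edge hwy hKwy,
      ncard_neighborSet_sup_edge hvz hKvz, e2, e1]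
    ring
  have q1 := genForm_sup_edge hzy.ne hKzy α f
  have q2 := genForm_sup_edge hvw.ne (not_adj_deleteEdges H v w) α f
  rw [hK1] at q1
  rw [hK2, q1] at q2
  have hQ : genForm α H f ≤ genForm α (edgeSwitch H v w z y) f := by
    rw [hH', genForm_sup_edge hwy hKwy, genForm_sup_edge hvz hKvz, q2]
    -- The change of the form is 2(f v - f y)(f z - f w); the α-terms cancel because every degree is
    -- kept.
    nlinarith [mul_nonneg (sub_nonneg.2 h1) (sub_nonneg.2 h2.le)]
  -- At v the neighbour w has been replaced by z with a strictly larger entry, so the action cannot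
  -- be unchanged.
  have hr := hf.rigid _ hc hd hQ v
  have a1 := genApply_sup_edge hzy.ne hKzy α f v
  have a2 := genApply_sup_edge hvw.ne (not_adj_deleteEdges H v w) α f v
  rw [hK1] at a1
  rw [hK2, a1] at a2
  rw [hH', genApply_sup_edge hwy hKwy, genApply_sup_edge hvz hKvz, a2] at hr
  simp only [if_true, if_neg hvz, if_neg hvy, if_neg hvw.ne] at hr
  linarith

/-- The edges from v to S are moved to u one at a time. The condition s ≠ u protects a possible edge
uv, which would otherwise become a loop. -/
theorem exists_shift (α : ℝ) (f : V → ℝ) (H : SimpleGraph V) {u v : V} (huv : u ≠ v)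
    (S : Finset V) (hS : ∀ s ∈ S, H.Adj v s ∧ ¬ H.Adj u s ∧ s ≠ u) :
    ∃ H' : SimpleGraph V,
      (∀ i j, H'.Adj i j ↔ (H.Adj i j ∧ ¬ (i = v ∧ j ∈ S) ∧ ¬ (j = v ∧ i ∈ S)) ∨
        (i = u ∧ j ∈ S) ∨ (j = u ∧ i ∈ S)) ∧
      (H'.neighborSet u).ncard = (H.neighborSet u).ncard + S.card ∧
      (H'.neighborSet v).ncard + S.card = (H.neighborSet v).ncard ∧
      (∀ i, i ≠ u → i ≠ v → (H'.neighborSet i).ncard = (H.neighborSet i).ncard) ∧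
      genForm α H' f = genForm α H f + ∑ s ∈ S, (2 * (f u - f v) * f s + α * (f u ^ 2 - f v ^ 2)) ∧
      genApply α H' f u = genApply α H f u + ∑ s ∈ S, (f s + α * f u) := by
  classical
  induction S using Finset.induction_on with
  | empty => exact ⟨H, by simp, by simp, by simp, by simp, by simp, by simp⟩
  | insert s S hs ih =>
    obtain ⟨X, hadj, hu, hv, ho, hQ, hA⟩ := ih fun x hx => hS x (Finset.mem_insert_of_mem hx)
    obtain ⟨hvs, hus, hsu⟩ := hS s (Finset.mem_insert_self _ _)
    have hvS : v ∉ S := fun h => H.irrefl (hS v (Finset.mem_insert_of_mem h)).1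
    have huS : u ∉ S := fun h => (hS u (Finset.mem_insert_of_mem h)).2.2 rfl
    have hXvs : X.Adj v s := by rw [hadj]; simp [hvs, hs, hvS]
    have hXus : ¬ X.Adj u s := by rw [hadj]; simp [hus, hs, hsu]
    set K := X.deleteEdges {s(v, s)} with hKdef
    have hK : K ⊔ SimpleGraph.edge v s = X := deleteEdges_sup_edge hXvs
    have hKvs : ¬ K.Adj v s := not_adj_deleteEdges _ _ _
    have hKus : ¬ K.Adj u s := fun h => hXus (by
      rw [hKdef, SimpleGraph.deleteEdges_adj] at h; exact h.1)
    have hsv : s ≠ v := hvs.ne'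
    have d1 (i) := ncard_neighborSet_sup_edge hvs.ne hKvs i
    have d2 (i) := ncard_neighborSet_sup_edge hsu.symm hKus i
    have q1 := genForm_sup_edge hvs.ne hKvs α f
    have q2 := genForm_sup_edge hsu.symm hKus α f
    have a1 := genApply_sup_edge hvs.ne hKvs α f u
    have a2 := genApply_sup_edge hsu.symm hKus α f u
    rw [hK] at d1 q1 a1
    refine ⟨K ⊔ SimpleGraph.edge u s, fun i j => ?_, ?_, ?_, fun i hiu hiv => ?_, ?_, ?_⟩
    · rw [SimpleGraph.sup_adj, hKdef, SimpleGraph.deleteEdges_adj, SimpleGraph.edge_adj, hadj]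
      simp only [Set.mem_singleton_iff, Sym2.eq_iff, Finset.mem_insert]
      have h1 := hvs.ne
      clear hadj hu hv ho hQ hA ih hK d1 d2 q1 q2 a1 a2 hKvs hKus hXvs hXus hS
      grind
    · have e1 := d1 u
      rw [if_neg huv, if_neg hsu.symm] at e1
      rw [d2, if_pos rfl, if_neg hsu.symm, Finset.card_insert_of_notMem hs]
      omega
    · have e1 := d1 v
      rw [if_pos rfl, if_neg hsv.symm] at e1
      rw [d2, if_neg huv.symm, if_neg hsv.symm, Finset.card_insert_of_notMem hs]
      omega
    · have e1 := d1 i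
      rw [if_neg hiv] at e1
      rw [d2, if_neg hiu, ← ho i hiu hiv, e1]
    · rw [q2, Finset.sum_insert hs]
      linarith
    · rw [if_neg huv, if_neg hsu.symm] at a1
      rw [if_pos rfl, if_neg hsu.symm] at a2
      rw [a2, Finset.sum_insert hs]
      linarith

/-- In an extremal graph the degrees are ordered as the entries of the Perron vector. -/
theorem IsPerronMax.ncard_le {α : ℝ} (hα : 0 ≤ α) {H : SimpleGraph V} {f : V → ℝ}
    (hf : IsPerronMax α H f) {u v : V} (huv : f v ≤ f u) :
    (H.neighborSet v).ncard ≤ (H.neighborSet u).ncard := by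
  classical
  by_contra hlt
  rw [not_le] at hlt
  have hne : u ≠ v := by rintro rfl; exact lt_irrefl _ hlt
  -- The neighbour a of v on a shortest path to u is never moved, so that v stays connected to u.
  obtain ⟨a, hva, ha⟩ : ∃ a, H.Adj v a ∧ H.dist a u < H.dist v u := by
    obtain ⟨p, hp⟩ := hf.connected.exists_walk_length_eq_dist v u
    cases p with
    | nil => exact absurd rfl hne
    | cons h q =>
      rename_i a
      refine ⟨a, h, ?_⟩
      have := SimpleGraph.dist_le q
      rw [SimpleGraph.Walk.length_cons] at hp
      omega
  let N := (H.neighborSet v).toFinset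
  let B := (H.neighborSet u).toFinset ∪ {u, a}
  have hN : N.card = (H.neighborSet v).ncard := (Set.ncard_eq_toFinset_card' _).symm
  have hNu : (H.neighborSet u).toFinset.card = (H.neighborSet u).ncard :=
    (Set.ncard_eq_toFinset_card' _).symm
  have hupos : 0 < (H.neighborSet u).ncard := by
    rw [Set.ncard_pos (Set.toFinite _)]
    obtain ⟨p⟩ := hf.connected.preconnected u v
    cases p with
    | nil => exact absurd rfl hne
    | cons h q => exact ⟨_, h⟩
  -- This leaves at least deg v - deg u movable neighbours. If v and u are adjacent, then a = u is
  -- forbidden but v itself is a neighbour of u outside N. If a is adjacent to u, the forbidden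
  -- vertices in N are all neighbours of u. Otherwise u and v have no common neighbour and only a is
  -- forbidden.
  have hNB : (N ∩ B).card ≤ (H.neighborSet u).ncard := by
    by_cases hadj : H.Adj v u
    · have hd : H.dist v u = 1 := SimpleGraph.dist_eq_one_iff_adj.2 hadj
      have hau : a = u := by
        rw [hd, Nat.lt_one_iff] at ha
        exact (hf.connected.preconnected a u).dist_eq_zero_iff.1 ha
      have hsub : N ∩ B ⊆ insert u ((H.neighborSet u).toFinset.erase v) := by
        intro x hx
        simp only [N, B, Finset.mem_inter, Set.mem_toFinset, SimpleGraph.mem_neighborSet,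
          Finset.mem_union, Finset.mem_insert, Finset.mem_singleton, hau, Finset.mem_erase] at hx ⊢
        have := hx.1.ne'
        tauto
      refine (Finset.card_le_card hsub).trans ((Finset.card_insert_le _ _).trans ?_)
      rw [Finset.card_erase_of_mem (by simpa using hadj.symm), hNu]
      omega
    · by_cases hau : H.Adj u a
      · rw [← hNu]
        refine Finset.card_le_card fun x hx => ?_
        simp only [N, B, Finset.mem_inter, Set.mem_toFinset, SimpleGraph.mem_neighborSet,
          Finset.mem_union, Finset.mem_insert, Finset.mem_singleton] at hx ⊢
        rcases hx with ⟨h1, h2 | rfl | rfl⟩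
        · exact h2
        · exact absurd h1 hadj
        · exact hau
      · have hsub : N ∩ B ⊆ {a} := by
          intro x hx
          simp only [N, B, Finset.mem_inter, Set.mem_toFinset, SimpleGraph.mem_neighborSet,
            Finset.mem_union, Finset.mem_insert, Finset.mem_singleton] at hx ⊢
          rcases hx with ⟨h1, h2 | rfl | rfl⟩
          · exfalso
            have hd2 : H.dist v u ≤ 2 :=
              SimpleGraph.dist_le (SimpleGraph.Walk.cons h1 (SimpleGraph.Walk.cons h2.symm .nil))
            have hau0 : H.dist a u ≤ 1 := by omega
            rcases Nat.le_one_iff_eq_zero_or_eq_one.1 hau0 with h0 | h0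
            · have := (hf.connected.preconnected a u).dist_eq_zero_iff.1 h0
              exact hadj (this ▸ hva)
            · exact hau (SimpleGraph.dist_eq_one_iff_adj.1 h0).symm
          · exact absurd h1 hadj
          · rfl
        exact (Finset.card_le_card hsub).trans (by rw [Finset.card_singleton]; exact hupos)
  have hcard : (H.neighborSet v).ncard - (H.neighborSet u).ncard ≤ (N \ B).card := by
    have := Finset.card_sdiff_add_card_inter N B
    omega
  obtain ⟨S, hSN, hScard⟩ := Finset.exists_subset_card_eq hcard
  have hS : ∀ s ∈ S, (H.Adj v s ∧ ¬ H.Adj u s ∧ s ≠ u) ∧ s ≠ a := by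
    intro s hs
    have := hSN hs
    simp only [N, B, Finset.mem_sdiff, Set.mem_toFinset, SimpleGraph.mem_neighborSet,
      Finset.mem_union, Finset.mem_insert, Finset.mem_singleton, not_or] at this
    exact ⟨⟨this.1, this.2.1, this.2.2.1⟩, this.2.2.2⟩
  obtain ⟨X, hadj, hXu, hXv, hXo, hQ, hA⟩ := exists_shift α f H hne S fun s hs => (hS s hs).1
  have haS : a ∉ S := fun h => (hS a h).2 rfl
  have hvS : v ∉ S := fun h => H.irrefl (hS v h).1.1
  -- A shortest path to u starting closer to u than v avoids v, so none of its edges is removed.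
  have hclose : ∀ k x, H.dist x u = k → k < H.dist v u → X.Reachable x u := by
    intro k
    induction k using Nat.strong_induction_on with
    | _ k ih =>
      intro x hx hk
      obtain ⟨p, hp⟩ := hf.connected.exists_walk_length_eq_dist x u
      cases p with
      | nil => exact SimpleGraph.Reachable.refl _
      | cons h q =>
        rename_i x'
        have h1 := SimpleGraph.dist_le q
        rw [SimpleGraph.Walk.length_cons] at hp
        have hxv : x ≠ v := by rintro rfl; omega
        have hxv' : x' ≠ v := by rintro rfl; omega
        refine SimpleGraph.Reachable.trans (SimpleGraph.Adj.reachable ?_)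
          (ih (H.dist x' u) (by omega) x' rfl (by omega))
        rw [hadj]
        exact Or.inl ⟨h, fun h => hxv h.1, fun h => hxv' h.1⟩
  have hvu : X.Reachable v u := by
    refine SimpleGraph.Reachable.trans (SimpleGraph.Adj.reachable ?_) (hclose _ a rfl ha)
    rw [hadj]
    exact Or.inl ⟨hva, fun h => haS h.2, fun h => hva.ne h.1.symm⟩
  have hXus : ∀ s ∈ S, X.Adj u s := fun s hs => (hadj u s).2 (Or.inr (Or.inl ⟨rfl, hs⟩))
  have hc : X.Connected := by
    refine connected_of_adj_reachable hf.connected fun i j hij => ?_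
    by_cases h1 : i = v ∧ j ∈ S
    · obtain ⟨rfl, hj⟩ := h1
      exact hvu.trans (hXus j hj).reachable
    by_cases h2 : j = v ∧ i ∈ S
    · obtain ⟨rfl, hi⟩ := h2
      exact (hvu.trans (hXus i hi).reachable).symm
    exact SimpleGraph.Adj.reachable ((hadj i j).2 (Or.inl ⟨hij, h1, h2⟩))
  have hd : SameDegrees H X := by
    -- The size of S is the difference of the two degrees, so the shift exchanges them.
    refine ⟨Equiv.swap u v, fun i => ?_⟩
    by_cases hiu : i = u
    · subst hiu; rw [Equiv.swap_apply_left]; omega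
    by_cases hiv : i = v
    · subst hiv; rw [Equiv.swap_apply_right]; omega
    rw [Equiv.swap_apply_of_ne_of_ne hiu hiv, hXo i hiu hiv]
  have hfv := hf.pos v
  have hfu := hf.pos u
  have hr := hf.rigid X hc hd (by
    rw [hQ, le_add_iff_nonneg_right]
    refine Finset.sum_nonneg fun s _ => ?_
    have hfs := hf.pos s
    have : f v ^ 2 ≤ f u ^ 2 := by nlinarith
    have := mul_nonneg hα (sub_nonneg.2 this)
    have := mul_nonneg (sub_nonneg.2 huv) hfs.le
    linarith) u
  rw [hA, add_eq_left] at hr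
  have hSne : S.Nonempty := by rw [← Finset.card_pos]; omega
  have : 0 < ∑ s ∈ S, (f s + α * f u) :=
    Finset.sum_pos (fun s _ => add_pos_of_pos_of_nonneg (hf.pos s) (mul_nonneg hα hfu.le)) hSne
  linarith

end EdgeMoves

/-! ### Unicyclic graphs as a rooted tree plus one edge. -/

section Rooted

variable {V : Type*}

/-- `H` consists of a tree with root `r`, parent map `p` and height `h`, and of one more edge `ab`
that avoids the root. -/
structure IsRootedWithEdge (H : SimpleGraph V) (r : V) (p : V → V) (h : V → ℕ) (a b : V) :
    Prop where
  par_root : p r = r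
  height_root : h r = 0
  height_par : ∀ z, z ≠ r → h z = h (p z) + 1
  adj_iff : ∀ i j, H.Adj i j ↔ (i ≠ r ∧ p i = j) ∨ (j ≠ r ∧ p j = i) ∨ (i = a ∧ j = b) ∨
    (i = b ∧ j = a)
  left_ne_root : a ≠ r
  right_ne_root : b ≠ r
  left_ne_right : a ≠ b
  par_left_ne : p a ≠ b
  par_right_ne : p b ≠ a

/-- `c` is an ancestor of `z`, or `z` itself, for the parent map `p`. -/
def IsAncestor (p : V → V) (c z : V) : Prop := ∃ k : ℕ, p^[k] z = c

theorem IsAncestor.refl (p : V → V) (z : V) : IsAncestor p z z := ⟨0, rfl⟩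

theorem isAncestor_par (p : V → V) (z : V) : IsAncestor p (p z) z := ⟨1, rfl⟩

theorem IsAncestor.trans {p : V → V} {x y z : V} (h1 : IsAncestor p x y) (h2 : IsAncestor p y z) :
    IsAncestor p x z := by
  obtain ⟨k, rfl⟩ := h1
  obtain ⟨l, rfl⟩ := h2
  exact ⟨k + l, Function.iterate_add_apply p k l z⟩

theorem IsAncestor.par_of_ne {p : V → V} {c z : V} (h : IsAncestor p c z) (hne : c ≠ z) :
    IsAncestor p c (p z) := by
  obtain ⟨k, hk⟩ := h
  cases k with
  | zero => exact absurd hk.symm hne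
  | succ k => exact ⟨k, hk⟩

theorem IsAncestor.reachable {p : V → V} {K : SimpleGraph V} {c z : V} (hc : IsAncestor p c z)
    (hK : ∀ i, IsAncestor p i z → IsAncestor p c i → i ≠ c → K.Adj i (p i)) :
    K.Reachable z c := by
  obtain ⟨k, hk⟩ := hc
  induction k generalizing z with
  | zero => rw [show z = c from hk]
  | succ k ih =>
    by_cases hz : z = c
    · rw [hz]
    · refine (hK z (IsAncestor.refl p z) ⟨_, hk⟩ hz).reachable.trans (ih ?_ hk)
      exact fun i hi => hK i (hi.trans (isAncestor_par p z))

namespace IsRootedWithEdge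

variable {H : SimpleGraph V} {r : V} {p : V → V} {h : V → ℕ} {a b : V}

theorem symm (R : IsRootedWithEdge H r p h a b) : IsRootedWithEdge H r p h b a where
  par_root := R.par_root
  height_root := R.height_root
  height_par := R.height_par
  adj_iff i j := by rw [R.adj_iff]; tauto
  left_ne_root := R.right_ne_root
  right_ne_root := R.left_ne_root
  left_ne_right := R.left_ne_right.symm
  par_left_ne := R.par_right_ne
  par_right_ne := R.par_left_ne

variable (R : IsRootedWithEdge H r p h a b)
include R

theorem adj_par {z : V} (hz : z ≠ r) : H.Adj z (p z) := (R.adj_iff _ _).2 (Or.inl ⟨hz, rfl⟩)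

theorem adj_extra : H.Adj a b := (R.adj_iff _ _).2 (Or.inr (Or.inr (Or.inl ⟨rfl, rfl⟩)))

theorem height_le {c z : V} (hc : IsAncestor p c z) : h c ≤ h z := by
  obtain ⟨k, rfl⟩ := hc
  induction k generalizing z with
  | zero => exact le_rfl
  | succ k ih =>
    rw [Function.iterate_succ_apply]
    refine (ih).trans ?_
    by_cases hz : z = r
    · rw [hz, R.par_root]
    · rw [R.height_par z hz]; omega

theorem height_lt {c z : V} (hc : IsAncestor p c z) (hne : c ≠ z) : h c < h z := by
  have h1 := R.height_le (hc.par_of_ne hne)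
  by_cases hz : z = r
  · exfalso
    obtain ⟨k, rfl⟩ := hc
    rw [hz, Function.iterate_fixed R.par_root] at hne
    exact hne rfl
  · rw [R.height_par z hz]; omega

theorem root_isAncestor (z : V) : IsAncestor p r z := by
  induction hk : h z using Nat.strong_induction_on generalizing z with
  | _ k ih =>
    by_cases hz : z = r
    · rw [hz]; exact IsAncestor.refl p r
    · have := R.height_par z hz
      exact (ih (h (p z)) (by omega) (p z) rfl).trans (isAncestor_par p z)

theorem par_edge_inj {i w : V} (hi : i ≠ r) (hw : w ≠ r) (he : s(i, p i) = s(w, p w)) :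
    i = w := by
  rcases Sym2.eq_iff.1 he with ⟨h1, -⟩ | ⟨h1, h2⟩
  · exact h1
  · have e1 := R.height_par i hi
    have e2 := R.height_par w hw
    rw [h2] at e1
    rw [← h1] at e2
    omega

theorem par_edge_ne_extra {i : V} : s(i, p i) ≠ s(a, b) := by
  intro he
  rcases Sym2.eq_iff.1 he with ⟨rfl, h2⟩ | ⟨rfl, h2⟩
  · exact R.par_left_ne h2
  · exact R.par_right_ne h2

/-- Deleting two edges does not separate a vertex from an ancestor if none of the edges lies on the
path of the tree between them. -/
theorem reachable_deleteEdges {e₁ e₂ : Sym2 V} {c z : V} (hc : IsAncestor p c z)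
    (hK : ∀ i, IsAncestor p i z → IsAncestor p c i → i ≠ c →
      s(i, p i) ≠ e₁ ∧ s(i, p i) ≠ e₂) :
    ((H.deleteEdges {e₁}).deleteEdges {e₂}).Reachable z c := by
  refine hc.reachable fun i hi hci hic => ?_
  have hir : i ≠ r := by
    rintro rfl
    have h1 := R.height_lt hci hic.symm
    rw [R.height_root] at h1
    omega
  rw [SimpleGraph.deleteEdges_adj, SimpleGraph.deleteEdges_adj]
  exact ⟨⟨R.adj_par hir, (hK i hi hci hic).1⟩, (hK i hi hci hic).2⟩

theorem adj_root_iff {w : V} : H.Adj r w ↔ w ≠ r ∧ p w = r := by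
  rw [R.adj_iff]
  have h1 := R.left_ne_root
  have h2 := R.right_ne_root
  constructor
  · rintro (⟨h, -⟩ | h | ⟨h, -⟩ | ⟨h, -⟩)
    · exact absurd rfl h
    · exact h
    · exact absurd h.symm h1
    · exact absurd h.symm h2
  · exact fun h => Or.inr (Or.inl h)

/-- Iterating the parent map beyond a child of the root stays at the root, so the number of
iterations from z to such a child is determined. -/
theorem isAncestor_top_unique {c c' z : V} (hc : IsAncestor p c z) (hc' : IsAncestor p c' z)
    (h1 : p c = r) (h2 : p c' = r) (h3 : c ≠ r) (h4 : c' ≠ r) : c = c' := by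
  have key : ∀ {c c' : V} {k l : ℕ}, p^[k] z = c → p^[l] z = c' → p c = r → c' ≠ r → l ≤ k := by
    intro c c' k l hk hl hp hr
    by_contra hlt
    obtain ⟨m, rfl⟩ : ∃ m, l = m + 1 + k := ⟨l - k - 1, by omega⟩
    rw [Function.iterate_add_apply, hk, Function.iterate_succ_apply, hp,
      Function.iterate_fixed R.par_root] at hl
    exact hr hl.symm
  obtain ⟨k, hk⟩ := hc
  obtain ⟨l, hl⟩ := hc'
  have : k = l := le_antisymm (key hl hk h2 h3) (key hk hl h1 h4)
  rw [← hk, ← hl, this]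

theorem eq_root_or_eq_of_isAncestor (hpa : p a = r) {z : V}
    (hz : IsAncestor p z a) : z = r ∨ z = a := by
  by_cases hza : z = a
  · exact Or.inr hza
  · left
    obtain ⟨k, hk⟩ := hz.par_of_ne hza
    rw [hpa, Function.iterate_fixed R.par_root] at hk
    exact hk.symm

variable [Fintype V]

theorem two_le_left : 2 ≤ (H.neighborSet a).ncard := by
  have hsub : ({p a, b} : Set V) ⊆ H.neighborSet a := by
    intro x hx
    rcases hx with rfl | rfl
    · exact R.adj_par R.left_ne_root
    · exact R.adj_extra
  have := Set.ncard_le_ncard hsub (Set.toFinite _)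
  rwa [Set.ncard_pair R.par_left_ne] at this

theorem two_le_of_child {z y : V} (hz : z ≠ r) (hy : y ≠ r) (hyz : p y = z) :
    2 ≤ (H.neighborSet z).ncard := by
  have hne : p z ≠ y := by
    rintro hh
    have e1 := R.height_par z hz
    have e2 := R.height_par y hy
    rw [hh] at e1; rw [hyz] at e2; omega
  have hsub : ({p z, y} : Set V) ⊆ H.neighborSet z := by
    intro x hx
    rcases hx with rfl | rfl
    · exact R.adj_par hz
    · exact (hyz ▸ R.adj_par hy).symm
  have := Set.ncard_le_ncard hsub (Set.toFinite _)
  rwa [Set.ncard_pair hne] at this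

theorem exists_child {z : V} (hza : z ≠ a) (hzb : z ≠ b)
    (hd : 2 ≤ (H.neighborSet z).ncard) : ∃ y, y ≠ r ∧ p y = z := by
  by_contra! hcon
  have hsub : H.neighborSet z ⊆ {p z} := by
    intro x hx
    rcases (R.adj_iff z x).1 hx with h1 | h1 | h1 | h1
    · exact h1.2.symm
    · exact absurd h1.2 (hcon x h1.1)
    · exact absurd h1.1 hza
    · exact absurd h1.1 hzb
  have := Set.ncard_le_ncard hsub (Set.toFinite _)
  rw [Set.ncard_singleton] at this
  omega

end IsRootedWithEdge

/-- The parent of a vertex is a neighbour one step closer to r. The parent edges are distinct, one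
fewer than the vertices, so exactly one edge is left over. It avoids r because every neighbour of r
has r as its parent. -/
theorem exists_isRootedWithEdge [Fintype V] {H : SimpleGraph V} (hH : H.Connected)
    (hcard : Nat.card H.edgeSet = Fintype.card V) (r : V) :
    ∃ p h a b, IsRootedWithEdge H r p h a b := by
  classical
  have hpar : ∀ z, ∃ w, (z = r → w = r) ∧ (z ≠ r → H.Adj z w ∧ H.dist z r = H.dist w r + 1) := by
    intro z
    by_cases hz : z = r
    · exact ⟨r, fun _ => rfl, fun h => absurd hz h⟩
    · obtain ⟨q, hq⟩ := hH.exists_walk_length_eq_dist z r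
      cases q with
      | nil => exact absurd rfl hz
      | cons hadj q =>
        rename_i w
        refine ⟨w, fun h => absurd h hz, fun _ => ⟨hadj, ?_⟩⟩
        have h1 := SimpleGraph.dist_le q
        rw [SimpleGraph.Walk.length_cons] at hq
        obtain ⟨q', hq'⟩ := hH.exists_walk_length_eq_dist w r
        have h2 := SimpleGraph.dist_le (SimpleGraph.Walk.cons hadj q')
        rw [SimpleGraph.Walk.length_cons] at h2
        omega
  choose p hp1 hp2 using hpar
  have hinj : Set.InjOn (fun z => s(z, p z)) (↑(Finset.univ.erase r) : Set V) := by
    intro i hi w hw he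
    have hi : i ≠ r := by simpa using hi
    have hw : w ≠ r := by simpa using hw
    rcases Sym2.eq_iff.1 he with ⟨h1, -⟩ | ⟨h1, h2⟩
    · exact h1
    · have e1 := (hp2 i hi).2
      have e2 := (hp2 w hw).2
      rw [h2] at e1
      rw [← h1] at e2
      omega
  let T := (Finset.univ.erase r).image fun z => s(z, p z)
  have hT : T.card + 1 = Fintype.card V := by
    rw [Finset.card_image_of_injOn hinj, Finset.card_erase_of_mem (Finset.mem_univ r),
      Finset.card_univ]
    have : 0 < Fintype.card V := Fintype.card_pos_iff.2 ⟨r⟩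
    omega
  have hTsub : T ⊆ H.edgeFinset := by
    intro e he
    obtain ⟨z, hz, rfl⟩ := Finset.mem_image.1 he
    rw [SimpleGraph.mem_edgeFinset]
    exact (hp2 z (by simpa using hz)).1
  have hE : (H.edgeFinset \ T).card = 1 := by
    rw [Finset.card_sdiff_of_subset hTsub, SimpleGraph.edgeFinset_card, ← Nat.card_eq_fintype_card,
      hcard]
    omega
  obtain ⟨e, he⟩ := Finset.card_eq_one.1 hE
  induction e using Sym2.ind with
  | _ a b =>
  have hmem (i j : V) : H.Adj i j ↔ s(i, j) ∈ T ∨ s(i, j) = s(a, b) := by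
    rw [← SimpleGraph.mem_edgeSet, ← SimpleGraph.mem_edgeFinset, ← Finset.mem_singleton, ← he,
      Finset.mem_sdiff]
    have := @hTsub s(i, j)
    tauto
  have hab : H.Adj a b ∧ s(a, b) ∉ T := by
    have : s(a, b) ∈ H.edgeFinset \ T := by rw [he]; exact Finset.mem_singleton_self _
    rw [Finset.mem_sdiff, SimpleGraph.mem_edgeFinset] at this
    exact this
  have hTmem (i j : V) : s(i, j) ∈ T ↔ (i ≠ r ∧ p i = j) ∨ (j ≠ r ∧ p j = i) := by
    simp only [T, Finset.mem_image, Finset.mem_erase, Finset.mem_univ, and_true, Sym2.eq_iff]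
    constructor
    · rintro ⟨z, hz, ⟨rfl, rfl⟩ | ⟨rfl, rfl⟩⟩
      · exact Or.inl ⟨hz, rfl⟩
      · exact Or.inr ⟨hz, rfl⟩
    · rintro (⟨hz, rfl⟩ | ⟨hz, rfl⟩)
      · exact ⟨i, hz, Or.inl ⟨rfl, rfl⟩⟩
      · exact ⟨j, hz, Or.inr ⟨rfl, rfl⟩⟩
  have hroot : ∀ w, H.Adj r w → s(r, w) ∈ T := by
    intro w hw
    have hwr : w ≠ r := hw.ne'
    have hd : H.dist w r = 1 := SimpleGraph.dist_eq_one_iff_adj.2 hw.symm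
    have h0 : H.dist (p w) r = 0 := by have := (hp2 w hwr).2; omega
    rw [hTmem]
    exact Or.inr ⟨hwr, (hH.preconnected _ _).dist_eq_zero_iff.1 h0⟩
  refine ⟨p, fun z => H.dist z r, a, b, hp1 r rfl, SimpleGraph.dist_self, fun z hz => (hp2 z hz).2,
    fun i j => ?_, ?_, ?_, hab.1.ne, ?_, ?_⟩
  · rw [hmem, hTmem, Sym2.eq_iff]; tauto
  · rintro rfl; exact hab.2 (hroot b hab.1)
  · rintro rfl; exact hab.2 (Sym2.eq_swap ▸ hroot a hab.1.symm)
  · intro hh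
    refine hab.2 ((hTmem a b).2 (Or.inl ⟨?_, hh⟩))
    rintro rfl; exact hab.2 (hroot b hab.1)
  · intro hh
    refine hab.2 ((hTmem a b).2 (Or.inr ⟨?_, hh⟩))
    rintro rfl; exact hab.2 (Sym2.eq_swap ▸ hroot a hab.1.symm)

end Rooted

/-! ### Perron entries along the tree of an extremal graph. -/

section Extremal

variable {V : Type*} [Fintype V] {α : ℝ} {H : SimpleGraph V} {f : V → ℝ} {r : V} {p : V → V}
  {h : V → ℕ} {a b : V}

namespace IsRootedWithEdge

/-- Among the counterexamples take x of greatest height. Its degree is at least that of b, hence at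
least 2, so it has a child w, and f w < f b by the choice of x. Trading xw, ab for xa, wb is then a
forbidden switch; x and b stay connected through the root. -/
theorem lt_of_not_isAncestor_aux (hα : 0 ≤ α) (hf : IsPerronMax α H f)
    (R : IsRootedWithEdge H r p h a b) (hab : f b ≤ f a) {z : V} (hza : ¬ IsAncestor p z a)
    (hzb : ¬ IsAncestor p z b) (hpa : p z ≠ a) (hpb : p z ≠ b) : f z < f b := by
  classical
  by_contra hlt
  let S := Finset.univ.filter fun z => ¬ IsAncestor p z a ∧ ¬ IsAncestor p z b ∧ p z ≠ a ∧
    p z ≠ b ∧ f b ≤ f z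
  have hS : S.Nonempty := ⟨z, by simp [S, hza, hzb, hpa, hpb, not_lt.1 hlt]⟩
  obtain ⟨x, hxS, hxmax⟩ := S.exists_max_image h hS
  obtain ⟨hxa, hxb, hxpa, hxpb, hxf⟩ : ¬ IsAncestor p x a ∧ ¬ IsAncestor p x b ∧ p x ≠ a ∧
    p x ≠ b ∧ f b ≤ f x := by simpa [S] using hxS
  have hxa' : x ≠ a := fun hh => hxa (hh ▸ IsAncestor.refl p x)
  have hxb' : x ≠ b := fun hh => hxb (hh ▸ IsAncestor.refl p x)
  have hxr : x ≠ r := fun hh => hxa (hh ▸ R.root_isAncestor a)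
  obtain ⟨w, hwr, hwx⟩ := R.exists_child hxa' hxb' (R.symm.two_le_left.trans (hf.ncard_le hα hxf))
  have hwx' : IsAncestor p x w := hwx ▸ isAncestor_par p w
  have hwa : ¬ IsAncestor p w a := fun hh => hxa (hwx'.trans hh)
  have hwb : ¬ IsAncestor p w b := fun hh => hxb (hwx'.trans hh)
  have hhw := R.height_par w hwr
  rw [hwx] at hhw
  have hwf : f w < f b := by
    by_contra hle
    have := hxmax w (by simp [S, hwa, hwb, hwx, hxa', hxb', not_lt.1 hle])
    omega
  have hwb' : w ≠ b := fun hh => hwb (hh ▸ IsAncestor.refl p w)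
  have hwa' : w ≠ a := fun hh => hwa (hh ▸ IsAncestor.refl p w)
  refine hf.not_switch (v := x) (w := w) (z := a) (y := b) (hwx ▸ R.adj_par hwr).symm R.adj_extra
    hxa' hwb' ?_ ?_ (Or.inr (Or.inl ?_)) hxf (hwf.trans_le hab)
  · rw [R.adj_iff]
    rintro (⟨-, h1⟩ | ⟨-, h1⟩ | ⟨h1, -⟩ | ⟨h1, -⟩)
    · exact hxpa h1
    · exact hxa (h1 ▸ isAncestor_par p a)
    · exact hxa' h1
    · exact hxb' h1
  · rw [R.adj_iff]
    rintro (⟨-, h1⟩ | ⟨-, h1⟩ | ⟨h1, -⟩ | ⟨h1, -⟩)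
    · exact hxb' (hwx.symm.trans h1)
    · exact hwb (h1 ▸ isAncestor_par p b)
    · exact hwa' h1
    · exact hwb' h1
  · have hstep : ∀ y, ¬ IsAncestor p w y →
        ((H.deleteEdges {s(x, w)}).deleteEdges {s(a, b)}).Reachable y r := by
      intro y hy
      refine R.reachable_deleteEdges (R.root_isAncestor y) fun i hi _ hir =>
        ⟨fun he => hy ?_, R.par_edge_ne_extra⟩
      rw [Sym2.eq_swap (a := x), ← hwx] at he
      rwa [← R.par_edge_inj hir hwr he]
    exact (hstep x fun hh => by have := R.height_le hh; omega).trans (hstep b hwb).symm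

/-- A vertex that is neither above the extra edge `ab` nor a child of one of its ends has a smaller
Perron entry than these ends. -/
theorem lt_of_not_isAncestor (hα : 0 ≤ α) (hf : IsPerronMax α H f)
    (R : IsRootedWithEdge H r p h a b) {z : V} (hza : ¬ IsAncestor p z a)
    (hzb : ¬ IsAncestor p z b) (hpa : p z ≠ a) (hpb : p z ≠ b) : f z < f a ∧ f z < f b := by
  rcases le_total (f b) (f a) with hab | hab
  · have := R.lt_of_not_isAncestor_aux hα hf hab hza hzb hpa hpb
    exact ⟨this.trans_le hab, this⟩
  · have := R.symm.lt_of_not_isAncestor_aux hα hf hab hzb hza hpb hpa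
    exact ⟨this, this.trans_le hab⟩

/-- Each of a and b lies below at most one child of the root, so a third child is off both branches.
-/
theorem exists_top_not_isAncestor (R : IsRootedWithEdge H r p h a b)
    (hd : 3 ≤ (H.neighborSet r).ncard) :
    ∃ w, w ≠ r ∧ p w = r ∧ ¬ IsAncestor p w a ∧ ¬ IsAncestor p w b := by
  classical
  by_contra! hcon
  have hle1 : ∀ x, ({w | w ≠ r ∧ p w = r ∧ IsAncestor p w x} : Set V).ncard ≤ 1 := by
    intro x
    rw [Set.ncard_le_one (Set.toFinite _)]
    rintro c ⟨h1, h2, h3⟩ c' ⟨h4, h5, h6⟩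
    exact R.isAncestor_top_unique h3 h6 h2 h5 h1 h4
  have hsub : H.neighborSet r ⊆ {w | w ≠ r ∧ p w = r ∧ IsAncestor p w a} ∪
      {w | w ≠ r ∧ p w = r ∧ IsAncestor p w b} := by
    intro w hw
    obtain ⟨h1, h2⟩ := R.adj_root_iff.1 hw
    by_cases h3 : IsAncestor p w a
    · exact Or.inl ⟨h1, h2, h3⟩
    · exact Or.inr ⟨h1, h2, hcon w h1 h2 h3⟩
  have := (Set.ncard_le_ncard hsub (Set.toFinite _)).trans (Set.ncard_union_le _ _)
  have := hle1 a
  have := hle1 b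
  omega

/-- The ends of the extra edge are children of the root. -/
theorem par_left_eq_root (hα : 0 ≤ α) (hf : IsPerronMax α H f) (R : IsRootedWithEdge H r p h a b)
    (hr : ∀ v, f v ≤ f r) (hd : 3 ≤ (H.neighborSet r).ncard) : p a = r := by
  by_contra hpa
  obtain ⟨w, hwr, hpw, hwa, hwb⟩ := R.exists_top_not_isAncestor hd
  have hlt := (R.lt_of_not_isAncestor hα hf hwa hwb (hpw ▸ R.left_ne_root.symm)
    (hpw ▸ R.right_ne_root.symm)).1
  have hwb' : w ≠ b := fun hh => hwb (hh ▸ IsAncestor.refl p w)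
  have hwa' : w ≠ a := fun hh => hwa (hh ▸ IsAncestor.refl p w)
  -- Were a not a child of r, the edges rw, ab could be traded for ra, wb, since f w < f a and f r
  -- is largest.
  refine hf.not_switch (v := r) (w := w) (z := a) (y := b) (R.adj_root_iff.2 ⟨hwr, hpw⟩)
    R.adj_extra R.left_ne_root.symm hwb' (fun hh => hpa (R.adj_root_iff.1 hh).2) ?_
    (Or.inr (Or.inl ?_)) (hr b) hlt
  · rw [R.adj_iff]
    rintro (⟨-, h1⟩ | ⟨-, h1⟩ | ⟨h1, -⟩ | ⟨h1, -⟩)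
    · exact R.right_ne_root (h1.symm.trans hpw)
    · exact hwb (h1 ▸ isAncestor_par p b)
    · exact hwa' h1
    · exact hwb' h1
  · refine (R.reachable_deleteEdges (R.root_isAncestor b) fun i hi _ hir =>
        ⟨fun he => hwb ?_, R.par_edge_ne_extra⟩).symm
    rw [Sym2.eq_swap (a := r), ← hpw] at he
    rwa [← R.par_edge_inj hir hwr he]

/-- No vertex outside the triangle has a larger Perron entry than a vertex of the triangle. -/
theorem le_left (hα : 0 ≤ α) (hf : IsPerronMax α H f) (R : IsRootedWithEdge H r p h a b)
    (hr : ∀ v, f v ≤ f r) (hpa : p a = r) (hpb : p b = r) {z : V} (hzr : z ≠ r) (hza : z ≠ a)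
    (hzb : z ≠ b) : f z ≤ f a := by
  by_cases hpz : p z = r
  · refine (R.lt_of_not_isAncestor hα hf (fun hh => ?_) (fun hh => ?_) (hpz ▸ R.left_ne_root.symm)
      (hpz ▸ R.right_ne_root.symm)).1.le
    · rcases R.eq_root_or_eq_of_isAncestor hpa hh with h1 | h1
      · exact hzr h1
      · exact hza h1
    · rcases R.symm.eq_root_or_eq_of_isAncestor hpb hh with h1 | h1
      · exact hzr h1
      · exact hzb h1
  · by_contra hlt
    rw [not_le] at hlt
    -- The larger entry forces degree at least 2, hence a child y. Trading ra, zy for rz, ay gains,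
    -- and the path r, b, a preserves connectedness.
    obtain ⟨y, hyr, hyz⟩ := R.exists_child hza hzb (R.two_le_left.trans (hf.ncard_le hα hlt.le))
    have hyb : y ≠ b := by rintro rfl; exact hzr (hyz.symm.trans hpb)
    have hya : y ≠ a := by rintro rfl; exact hzr (hyz.symm.trans hpa)
    refine hf.not_switch (v := r) (w := a) (z := z) (y := y)
      (R.adj_root_iff.2 ⟨R.left_ne_root, hpa⟩) (hyz ▸ R.adj_par hyr).symm hzr.symm hya.symm
      (fun hh => hpz (R.adj_root_iff.1 hh).2) ?_ (Or.inl ?_) (hr y) hlt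
    · rw [R.adj_iff]
      rintro (⟨-, h1⟩ | ⟨-, h1⟩ | ⟨-, h1⟩ | ⟨-, h1⟩)
      · exact hyr (h1.symm.trans hpa)
      · exact hza (hyz.symm.trans h1)
      · exact hyb h1
      · exact hya h1
    · have h1 : ((H.deleteEdges {s(r, a)}).deleteEdges {s(z, y)}).Adj r b := by
        rw [SimpleGraph.deleteEdges_adj, SimpleGraph.deleteEdges_adj]
        refine ⟨⟨R.adj_root_iff.2 ⟨R.right_ne_root, hpb⟩, ?_⟩, ?_⟩ <;>
          rw [Set.mem_singleton_iff, Sym2.eq_iff]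
        · rintro (⟨-, h1⟩ | ⟨h1, -⟩)
          · exact R.left_ne_right h1.symm
          · exact R.left_ne_root h1.symm
        · rintro (⟨h1, -⟩ | ⟨h1, -⟩)
          · exact hzr h1.symm
          · exact hyr h1.symm
      have h2 : ((H.deleteEdges {s(r, a)}).deleteEdges {s(z, y)}).Adj b a := by
        rw [SimpleGraph.deleteEdges_adj, SimpleGraph.deleteEdges_adj]
        refine ⟨⟨R.adj_extra.symm, ?_⟩, ?_⟩ <;>
          rw [Set.mem_singleton_iff, Sym2.eq_iff]
        · rintro (⟨h1, -⟩ | ⟨h1, -⟩)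
          · exact R.right_ne_root h1
          · exact R.left_ne_right h1.symm
        · rintro (⟨h1, -⟩ | ⟨h1, -⟩)
          · exact hzb h1.symm
          · exact hyb h1.symm
      exact h1.reachable.trans h2.reachable

/-- Perron entries do not increase from a vertex to its children. -/
theorem le_par (hα : 0 ≤ α) (hf : IsPerronMax α H f) (R : IsRootedWithEdge H r p h a b)
    (hr : ∀ v, f v ≤ f r) (hpa : p a = r) (hpb : p b = r) (z : V) : f z ≤ f (p z) := by
  classical
  by_contra hlt
  let S := Finset.univ.filter fun z => f (p z) < f z
  -- Choosing the violation with the largest entry ensures below that no child of x exceeds x.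
  obtain ⟨x, hxS, hxmax⟩ := S.exists_max_image f ⟨z, by simpa [S] using hlt⟩
  have hx : f (p x) < f x := by simpa [S] using hxS
  have hpxr : p x ≠ r := fun hh => absurd (hr x) (by rw [← hh]; exact not_le.2 hx)
  have hxr : x ≠ r := by rintro rfl; rw [R.par_root] at hx; exact lt_irrefl _ hx
  have hxa : x ≠ a := by rintro rfl; exact hpxr hpa
  have hxb : x ≠ b := by rintro rfl; exact hpxr hpb
  -- the lowest ancestor that is not smaller than `x`
  have hex : ∃ k, f x ≤ f (p^[k + 1] x) := by
    obtain ⟨k, hk⟩ := (R.root_isAncestor x).par_of_ne hxr.symm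
    exact ⟨k, by rw [Function.iterate_succ_apply, hk]; exact hr x⟩
  obtain ⟨k, hk, hkmin⟩ : ∃ k, f x ≤ f (p^[k + 1] x) ∧ ∀ l < k, ¬ f x ≤ f (p^[l + 1] x) :=
    ⟨Nat.find hex, Nat.find_spec hex, fun l hl => Nat.find_min hex hl⟩
  obtain ⟨l, rfl⟩ : ∃ l, k = l + 1 := by
    cases k with
    | zero => exact absurd hk (not_le.2 (by simpa using hx))
    | succ l => exact ⟨l, rfl⟩
  set w := p^[l + 1] x with hw
  have hwx : f w < f x := not_le.1 (hkmin l (Nat.lt_succ_self l))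
  rw [Function.iterate_succ_apply', ← hw] at hk
  have hwpx : IsAncestor p w (p x) := ⟨l, by rw [hw, Function.iterate_succ_apply]⟩
  have hwr : w ≠ r := by
    intro hh
    rw [hh] at hwx
    exact absurd (hr x) (not_le.2 hwx)
  have hwanc : IsAncestor p w x := hwpx.trans (isAncestor_par p x)
  have hhx := R.height_par x hxr
  have hhw := R.height_par w hwr
  have hhwx := R.height_le hwpx
  have hwdeg : 2 ≤ (H.neighborSet w).ncard := by
    have : ∃ y, y ≠ r ∧ p y = w := by
      refine ⟨p^[l] x, fun hh => hwr ?_, by rw [hw, Function.iterate_succ_apply']⟩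
      rw [hw, Function.iterate_succ_apply', hh, R.par_root]
    obtain ⟨y, hy, hyw⟩ := this
    exact R.two_le_of_child hwr hy hyw
  obtain ⟨y, hyr, hyx⟩ := R.exists_child hxa hxb (hwdeg.trans (hf.ncard_le hα hwx.le))
  have hhy := R.height_par y hyr
  rw [hyx] at hhy
  have hyf : f y ≤ f x := by
    by_contra hh
    rw [not_le] at hh
    exact absurd (hxmax y (by simpa [S, hyx] using hh)) (not_le.2 hh)
  have hyb : y ≠ b := by rintro rfl; exact hxr (hyx.symm.trans hpb)
  have hya : y ≠ a := by rintro rfl; exact hxr (hyx.symm.trans hpa)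
  -- Here f w < f x ≤ f (p w) and f y ≤ f x: the switch hangs x under p w and y under w, while the
  -- tree path from x up to w survives.
  refine hf.not_switch (v := p w) (w := w) (z := x) (y := y) (R.adj_par hwr).symm
    (hyx ▸ R.adj_par hyr).symm ?_ ?_ ?_ ?_ (Or.inr (Or.inr (Or.inl ?_))) (hyf.trans hk) hwx
  · rintro hh; rw [hh] at hhw; omega
  · rintro hh; rw [← hh] at hhy; omega
  · rw [R.adj_iff]
    rintro (⟨h0, h1⟩ | ⟨-, h1⟩ | ⟨-, h1⟩ | ⟨-, h1⟩)
    · have := R.height_par _ h0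
      rw [h1] at this; omega
    · rw [← h1] at hhw; omega
    · exact hxb h1
    · exact hxa h1
  · rw [R.adj_iff]
    rintro (⟨h0, h1⟩ | ⟨-, h1⟩ | ⟨-, h1⟩ | ⟨-, h1⟩)
    · rw [h1] at hhw; omega
    · exact hwx.ne (congrArg f (h1.symm.trans hyx))
    · exact hyb h1
    · exact hya h1
  · refine R.reachable_deleteEdges hwanc fun i hi hwi hiw => ?_
    have hir : i ≠ r := by
      rintro rfl
      have := R.height_le hwi
      rw [R.height_root] at this
      omega
    refine ⟨fun he => hiw ?_, fun he => ?_⟩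
    · rw [Sym2.eq_swap (a := p w)] at he
      exact R.par_edge_inj hir hwr he
    · rw [Sym2.eq_swap (a := x), ← hyx] at he
      have hiy := R.par_edge_inj hir hyr he
      have := R.height_le hi
      rw [hiy] at this
      omega

/-- Perron entries of children follow those of their parents. -/
theorem le_of_par_le (hα : 0 ≤ α) (hf : IsPerronMax α H f) (R : IsRootedWithEdge H r p h a b)
    (hr : ∀ v, f v ≤ f r) (hpa : p a = r) (hpb : p b = r) {w z : V} (hwr : w ≠ r) (hzr : z ≠ r)
    (hne : p w ≠ p z) (hanc : ¬ IsAncestor p (p z) (p w)) (hle : f (p z) ≤ f (p w)) :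
    f z ≤ f w := by
  by_contra hlt
  rw [not_le] at hlt
  have hmono : ∀ {c x : V}, IsAncestor p c x → f x ≤ f c := by
    rintro c x ⟨k, rfl⟩
    induction k generalizing x with
    | zero => exact le_rfl
    | succ k ih =>
      rw [Function.iterate_succ_apply]
      exact (R.le_par hα hf hr hpa hpb x).trans ih
  have hwx : ¬ IsAncestor p w (p z) := fun hh =>
    absurd (hmono (hh.trans (isAncestor_par p z))) (not_le.2 hlt)
  have hzu : ¬ IsAncestor p z (p w) := fun hh => hanc ((isAncestor_par p z).trans hh)
  have hhw := R.height_par w hwr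
  have hhz := R.height_par z hzr
  -- The two children exchange parents. Monotonicity along the tree keeps w from lying above p z, so
  -- both parents still reach the root.
  refine hf.not_switch (v := p w) (w := w) (z := z) (y := p z) (R.adj_par hwr).symm
    (R.adj_par hzr) (fun hh => hzu (hh ▸ IsAncestor.refl p _))
    (fun hh => hwx (hh ▸ IsAncestor.refl p _)) ?_ ?_ (Or.inr (Or.inl ?_)) hle hlt
  · rw [R.adj_iff]
    rintro (⟨-, h1⟩ | ⟨-, h1⟩ | ⟨-, h1⟩ | ⟨-, h1⟩)
    · exact hzu (h1 ▸ isAncestor_par p (p w))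
    · exact hne h1.symm
    · exact hanc (by rw [h1, hpb]; exact R.root_isAncestor _)
    · exact hanc (by rw [h1, hpa]; exact R.root_isAncestor _)
  · rw [R.adj_iff]
    rintro (⟨-, h1⟩ | ⟨-, h1⟩ | ⟨h0, h1⟩ | ⟨h0, h1⟩)
    · exact hne h1
    · exact hwx (h1 ▸ isAncestor_par p (p z))
    -- An edge between w and p z can also be the extra edge; then w is on the triangle, and z, lying
    -- outside it, cannot exceed w.
    · rw [h0] at hlt
      refine absurd (R.le_left hα hf hr hpa hpb hzr ?_ ?_) (not_le.2 hlt)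
      · rintro rfl; exact R.right_ne_root (h1.symm.trans hpa)
      · rintro rfl; exact R.right_ne_root (h1.symm.trans hpb)
    · rw [h0] at hlt
      refine absurd (R.symm.le_left hα hf hr hpb hpa hzr ?_ ?_) (not_le.2 hlt)
      · rintro rfl; exact R.left_ne_root (h1.symm.trans hpb)
      · rintro rfl; exact R.left_ne_root (h1.symm.trans hpa)
  · have hstep : ∀ y, ¬ IsAncestor p w y → ¬ IsAncestor p z y →
        ((H.deleteEdges {s(p w, w)}).deleteEdges {s(z, p z)}).Reachable y r := by
      intro y hy hy'
      refine R.reachable_deleteEdges (R.root_isAncestor y) fun i hi _ hir =>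
        ⟨fun he => hy ?_, fun he => hy' ?_⟩
      · rw [Sym2.eq_swap (a := p w)] at he
        rwa [← R.par_edge_inj hir hwr he]
      · rwa [← R.par_edge_inj hir hzr he]
    exact (hstep (p w) (fun hh => by have := R.height_le hh; omega) hzu).trans
      (hstep (p z) hwx (fun hh => by have := R.height_le hh; omega)).symm

end IsRootedWithEdge

end Extremal

/-! ### Layered unicyclic graphs: uniqueness, distances and the cycle. -/

section Layered

/-- A tree on `Fin m` with root `0` and monotone parent map `q`, together with the edge joining the
children `1` and `2` of the root. -/
structure IsLayeredUnicyclic {m : ℕ} (G : SimpleGraph (Fin m)) (q : Fin m → Fin m) : Prop where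
  three_le : 3 ≤ m
  par_lt : ∀ i : Fin m, i.val ≠ 0 → q i < i
  par_zero : ∀ i : Fin m, i.val ≤ 2 → (q i).val = 0
  monotone : Monotone q
  adj_iff : ∀ i j : Fin m, G.Adj i j ↔ (i.val ≠ 0 ∧ q i = j) ∨ (j.val ≠ 0 ∧ q j = i) ∨
    (i.val = 1 ∧ j.val = 2) ∨ (i.val = 2 ∧ j.val = 1)

theorem mem_iff_val_lt_card {m : ℕ} {A : Finset (Fin m)} (hA : ∀ i ∈ A, ∀ j ≤ i, j ∈ A)
    (k : Fin m) : k ∈ A ↔ k.val < A.card := by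
  constructor
  · intro hk
    have : Finset.Iic k ⊆ A := fun j hj => hA k hk j (Finset.mem_Iic.1 hj)
    have := Finset.card_le_card this
    rw [Fin.card_Iic] at this
    omega
  · intro hk
    by_contra hkA
    have : A ⊆ Finset.Iio k := fun j hj => Finset.mem_Iio.2 (by
      by_contra hle
      exact hkA (hA j hj k (not_lt.1 hle)))
    have := Finset.card_le_card this
    rw [Fin.card_Iio] at this
    omega

namespace IsLayeredUnicyclic

variable {m : ℕ} {G : SimpleGraph (Fin m)} {q : Fin m → Fin m} (L : IsLayeredUnicyclic G q)
include L

theorem childCount_eq {d : Fin m → ℕ} (hd : ∀ i, (G.neighborSet i).ncard = d i) (i : Fin m) :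
    childCount d i = (Finset.univ.filter fun k : Fin m => k.val ≠ 0 ∧ q k = i).card := by
  classical
  have hm := L.three_le
  set C := Finset.univ.filter fun k : Fin m => k.val ≠ 0 ∧ q k = i with hC
  have hmemC : ∀ k, k ∈ C ↔ k.val ≠ 0 ∧ q k = i := fun k => by simp [hC]
  have hCgt : ∀ k ∈ C, i < k := fun k hk => by
    obtain ⟨h1, h2⟩ := (hmemC k).1 hk
    exact h2 ▸ L.par_lt k h1
  have hnc : ∀ B : Finset (Fin m), (∀ j, G.Adj i j ↔ j ∈ C ∨ j ∈ B) → Disjoint C B →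
      d i = C.card + B.card := by
    intro B hB hdisj
    rw [← hd, ← Finset.card_union_of_disjoint hdisj, ← Set.ncard_coe_finset]
    congr 1
    ext j
    simp [hB]
  unfold childCount
  split_ifs with h0 h2
  · rw [hnc ∅ (fun j => ?_) (Finset.disjoint_empty_right _), Finset.card_empty, add_zero]
    rw [L.adj_iff, hmemC]
    simp [h0]
  · -- the other vertex of the extra edge
    obtain ⟨j', hj'⟩ : ∃ j' : Fin m, j'.val = 3 - i.val := ⟨⟨3 - i.val, by omega⟩, rfl⟩
    have hj0 : q j' ≠ i := fun hh => by
      have := L.par_zero j' (by omega)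
      rw [hh] at this
      exact h0 this
    have hqi := L.par_zero i h2
    have hne : q i ≠ j' := fun hh => by rw [hh] at hqi; omega
    rw [hnc {q i, j'} (fun j => ?_) ?_, Finset.card_pair hne, Nat.add_sub_cancel]
    · rw [Finset.disjoint_right]
      intro k hk hkC
      rcases Finset.mem_insert.1 hk with rfl | hk
      · exact absurd (hCgt _ hkC) (not_lt.2 (L.par_lt i h0).le)
      · rw [Finset.mem_singleton] at hk
        exact hj0 (hk ▸ ((hmemC k).1 hkC).2)
    · rw [L.adj_iff, hmemC, Finset.mem_insert, Finset.mem_singleton, Fin.ext_iff (b := j'), hj',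
        eq_comm (a := j) (b := q i)]
      constructor
      · rintro (h | h | h | h)
        · exact Or.inr (Or.inl h.2)
        · exact Or.inl h
        · exact Or.inr (Or.inr (by omega))
        · exact Or.inr (Or.inr (by omega))
      · rintro (h | h | h)
        · exact Or.inr (Or.inl h)
        · exact Or.inl ⟨h0, h⟩
        · exact Or.inr (Or.inr (by omega))
  · rw [hnc {q i} (fun j => ?_) ?_, Finset.card_singleton, Nat.add_sub_cancel]
    · rw [Finset.disjoint_singleton_right]
      exact fun hkC => absurd (hCgt _ hkC) (not_lt.2 (L.par_lt i h0).le)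
    · rw [L.adj_iff, hmemC, Finset.mem_singleton, eq_comm (a := j) (b := q i)]
      constructor
      · rintro (h | h | h | h)
        · exact Or.inr h.2
        · exact Or.inl h
        · omega
        · omega
      · rintro (h | h)
        · exact Or.inr (Or.inl h)
        · exact Or.inl ⟨h0, h⟩

/-- By monotonicity of q, the root together with the children of an initial segment is again an
initial segment, so it is determined by its size. The children of i are the difference of these
segments for the vertices up to i and those before i. -/
theorem mem_children_iff {d : Fin m → ℕ} (hd : ∀ i, (G.neighborSet i).ncard = d i)
    (i k : Fin m) : (firstChild d i ≤ k.val ∧ k.val < firstChild d i + childCount d i) ↔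
      (k.val ≠ 0 ∧ q k = i) := by
  classical
  have hm := L.three_le
  let z : Fin m := ⟨0, by omega⟩
  let A (T : Finset (Fin m)) : Finset (Fin m) :=
    insert z (Finset.univ.filter fun k : Fin m => k.val ≠ 0 ∧ q k ∈ T)
  have hmem (T : Finset (Fin m)) (k : Fin m) : k ∈ A T ↔ k.val = 0 ∨ q k ∈ T := by
    have : k = z ↔ k.val = 0 := by rw [Fin.ext_iff]
    simp only [A, Finset.mem_insert, Finset.mem_filter, Finset.mem_univ, true_and, this]
    tauto
  have hcard (T : Finset (Fin m)) : (A T).card = 1 + ∑ j ∈ T, childCount d j := by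
    rw [Finset.card_insert_of_notMem (by simp [z]), add_comm]
    congr 1
    rw [Finset.card_eq_sum_card_fiberwise (f := q) (t := T) (fun k hk => by
        simp only [Finset.coe_filter, Finset.mem_univ, true_and, Set.mem_ofPred_eq] at hk
        exact hk.2)]
    refine Finset.sum_congr rfl fun j hj => ?_
    rw [L.childCount_eq hd]
    congr 1
    ext k
    simp only [Finset.mem_filter, Finset.mem_univ, true_and]
    constructor
    · rintro ⟨⟨h1, -⟩, h2⟩; exact ⟨h1, h2⟩
    · rintro ⟨h1, h2⟩; exact ⟨⟨h1, h2 ▸ hj⟩, h2⟩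
  have hlow (T : Finset (Fin m)) (hT : ∀ x y, x ≤ y → y ∈ T → x ∈ T) :
      ∀ i ∈ A T, ∀ j ≤ i, j ∈ A T := by
    intro i hi j hj
    rw [hmem] at hi ⊢
    rcases hi with hi | hi
    · left
      have : j.val ≤ i.val := hj
      omega
    · exact Or.inr (hT _ _ (L.monotone hj) hi)
  have h1 := mem_iff_val_lt_card (hlow (Finset.Iio i) fun x y hxy hy =>
    Finset.mem_Iio.2 (lt_of_le_of_lt hxy (Finset.mem_Iio.1 hy))) k
  have h2 := mem_iff_val_lt_card (hlow (Finset.Iic i) fun x y hxy hy =>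
    Finset.mem_Iic.2 (le_trans hxy (Finset.mem_Iic.1 hy))) k
  have h4 : firstChild d i = (A (Finset.Iio i)).card := by
    rw [hcard, firstChild, Finset.filter_gt_eq_Iio]
  have h3 : firstChild d i + childCount d i = (A (Finset.Iic i)).card := by
    rw [hcard, h4, hcard, add_assoc, ← Finset.Iio_insert i, Finset.sum_insert (by simp),
      add_comm (childCount d i)]
  rw [h3, ← h2, hmem, ← not_lt, h4, ← h1, hmem, not_or, Finset.mem_Iio, Finset.mem_Iic, not_lt]
  constructor
  · rintro ⟨⟨h5, h6⟩, h7 | h7⟩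
    · exact absurd h7 h5
    · exact ⟨h5, le_antisymm h7 h6⟩
  · rintro ⟨h5, rfl⟩
    exact ⟨⟨h5, le_rfl⟩, Or.inr le_rfl⟩

/-- A layered unicyclic graph is determined by its degrees. -/
theorem eq_bfsUnicyclic {d : Fin m → ℕ} (hd : ∀ i, (G.neighborSet i).ncard = d i) :
    G = bfsUnicyclic d := by
  ext i j
  rw [bfsUnicyclic, SimpleGraph.fromRel_adj, L.mem_children_iff hd, L.mem_children_iff hd]
  have := L.adj_iff i j
  constructor
  · intro h
    refine ⟨h.ne, ?_⟩
    rw [this] at h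
    tauto
  · intro h
    rw [this]
    tauto

/-- A shortest path from a vertex beyond the triangle cannot start with a step to a child, which by
induction is farther from the root, so it starts with the parent. -/
theorem dist_eq (hG : G.Connected) {r : Fin m} (hr : r.val = 0) (i : Fin m) (hi : i.val ≠ 0) :
    G.dist i r = G.dist (q i) r + 1 := by
  have hr0 : ∀ j : Fin m, j.val = 0 → j = r := fun j hj => Fin.ext (hj.trans hr.symm)
  induction hk : G.dist i r using Nat.strong_induction_on generalizing i with
  | _ k ih =>
    subst hk
    have hadj : G.Adj i (q i) := (L.adj_iff _ _).2 (Or.inl ⟨hi, rfl⟩)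
    by_cases hi2 : i.val ≤ 2
    · have hq := hr0 _ (L.par_zero i hi2)
      rw [hq] at hadj ⊢
      rw [SimpleGraph.dist_self, SimpleGraph.dist_eq_one_iff_adj.2 hadj]
    · obtain ⟨w, hw⟩ := hG.exists_walk_length_eq_dist i r
      have hle : G.dist i r ≤ G.dist (q i) r + 1 := by
        obtain ⟨w', hw'⟩ := hG.exists_walk_length_eq_dist (q i) r
        have := SimpleGraph.dist_le (SimpleGraph.Walk.cons hadj w')
        rwa [SimpleGraph.Walk.length_cons, hw'] at this
      cases w with
      | nil => exact absurd hr hi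
      | cons h w =>
        rename_i x
        have hx := SimpleGraph.dist_le w
        rw [SimpleGraph.Walk.length_cons] at hw
        rcases (L.adj_iff i x).1 h with h1 | h1 | h1 | h1
        · rw [h1.2] at hle ⊢; omega
        · have := ih (G.dist x r) (by omega) x h1.1 rfl
          rw [h1.2] at this
          omega
        · omega
        · omega

theorem isBFSOrdering (hG : G.Connected) {r : Fin m} (hr : r.val = 0)
    (hdeg : ∀ u v, u ≤ v → (G.neighborSet v).ncard ≤ (G.neighborSet u).ncard) :
    IsBFSOrdering G r where
  root_le v := by rw [Fin.le_def, hr]; exact Nat.zero_le _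
  degree_anti := hdeg
  height_mono u v huv := by
    induction hv : v.val using Nat.strong_induction_on generalizing u v with
    | _ k ih =>
      by_cases hu0 : u.val = 0
      · rw [show u = r from Fin.ext (hu0.trans hr.symm), SimpleGraph.dist_self]
        exact Nat.zero_le _
      · have huv' : u.val ≤ v.val := huv
        have hlt : (q v).val < v.val := L.par_lt v (by omega)
        rw [L.dist_eq hG hr u hu0, L.dist_eq hG hr v (by omega)]
        exact Nat.succ_le_succ (ih (q v).val (by omega) _ _ (L.monotone huv) rfl)
  children_order u x v y huv hxv hxy huy h1 h2 h3 hux := by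
    -- The ends of the extra edge share their parent and hence their distance, so only tree edges
    -- lead one layer down.
    have key : ∀ c e, G.Adj c e → G.dist e r = G.dist c r + 1 → q e = c := by
      intro c e hce hd
      rcases (L.adj_iff c e).1 hce with h | h | h | h
      · have := L.dist_eq hG hr c h.1
        rw [h.2] at this
        omega
      · exact h.2
      · have e1 := L.dist_eq hG hr c (by omega)
        have e2 := L.dist_eq hG hr e (by omega)
        have : q c = q e := Fin.ext (by rw [L.par_zero c (by omega), L.par_zero e (by omega)])
        rw [this] at e1
        omega
      · have e1 := L.dist_eq hG hr c (by omega)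
        have e2 := L.dist_eq hG hr e (by omega)
        have : q c = q e := Fin.ext (by rw [L.par_zero c (by omega), L.par_zero e (by omega)])
        rw [this] at e1
        omega
    have hv := key u v huv h2
    have hy := key x y hxy (by omega)
    by_contra hle
    have := L.monotone (not_lt.1 hle)
    rw [hv, hy] at this
    exact absurd hux (not_lt.2 this)

/-- The largest vertex of a cycle has two smaller neighbours on it. Beyond vertex 2 only the parent
is a smaller neighbour, so the cycle lives on 0, 1, 2. -/
theorem mem_support_isCycle_iff {v : Fin m} {w : G.Walk v v} (hw : w.IsCycle) (i : Fin m) :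
    i ∈ w.support ↔ i.val < 3 := by
  classical
  have hm := L.three_le
  obtain ⟨x, hx, hmax⟩ := w.support.toFinset.exists_max_image id ⟨v, by simp⟩
  simp only [List.mem_toFinset, id] at hx hmax
  obtain ⟨y, z, hyz, hN⟩ := Set.ncard_eq_two.1 (hw.ncard_neighborSet_toSubgraph_eq_two hx)
  have hprop : ∀ j, j ∈ w.toSubgraph.neighborSet x → G.Adj x j ∧ j ∈ w.support ∧ j < x := by
    intro j hj
    have h1 : w.toSubgraph.Adj x j := hj
    have h2 : j ∈ w.support := w.mem_verts_toSubgraph.1 h1.snd_mem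
    exact ⟨h1.adj_sub, h2, lt_of_le_of_ne (hmax j h2) h1.adj_sub.ne'⟩
  obtain ⟨hy1, hy2, hy3⟩ := hprop y (by rw [hN]; simp)
  obtain ⟨hz1, hz2, hz3⟩ := hprop z (by rw [hN]; simp)
  have hx2 : x.val ≤ 2 := by
    by_contra hx2
    have key : ∀ j, G.Adj x j → j < x → q x = j := by
      intro j hj hlt
      rcases (L.adj_iff x j).1 hj with h | h | h | h
      · exact h.2
      · have := L.par_lt j h.1
        rw [h.2] at this
        exact absurd hlt (not_lt.2 this.le)
      · omega
      · omega
    exact hyz ((key y hy1 hy3).symm.trans (key z hz1 hz3))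
  have hyz' : y.val ≠ z.val := fun hh => hyz (Fin.ext hh)
  rw [Fin.lt_def] at hy3 hz3
  constructor
  · intro hi
    have : i.val ≤ x.val := hmax i hi
    omega
  · intro hi
    have : i.val = x.val ∨ i.val = y.val ∨ i.val = z.val := by omega
    rcases this with h | h | h
    · rwa [Fin.ext h]
    · rwa [Fin.ext h]
    · rwa [Fin.ext h]

theorem adj_of_lt_three {i j : Fin m} (hi : i.val < 3) (hj : j.val < 3) (hij : i ≠ j) :
    G.Adj i j := by
  have hne : i.val ≠ j.val := fun hh => hij (Fin.ext hh)
  rw [L.adj_iff]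
  by_cases h0 : i.val = 0
  · exact Or.inr (Or.inl ⟨by omega, Fin.ext (by rw [L.par_zero j (by omega), h0])⟩)
  by_cases h1 : j.val = 0
  · exact Or.inl ⟨by omega, Fin.ext (by rw [L.par_zero i (by omega), h1])⟩
  omega

end IsLayeredUnicyclic

end Layered

/-! ### The breadth-first numbering of an extremal graph. -/

section Ordering

theorem exists_equiv_of_key {m : ℕ} {L : Type*} [LinearOrder L] (key : Fin m → L)
    (hkey : Function.Injective key) :
    ∃ e : Equiv.Perm (Fin m), ∀ x y, e x ≤ e y ↔ key x ≤ key y := by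
  classical
  have hcard : (Finset.univ.image key).card = m := by
    rw [Finset.card_image_of_injective _ hkey, Finset.card_univ, Fintype.card_fin]
  let o := Finset.orderIsoOfFin _ hcard
  let k : Fin m → {y // y ∈ Finset.univ.image key} := fun x =>
    ⟨key x, Finset.mem_image_of_mem _ (Finset.mem_univ x)⟩
  have hinj : Function.Injective fun x => o.symm (k x) := by
    intro x y hxy
    exact hkey (congrArg Subtype.val (o.symm.injective hxy))
  refine ⟨Equiv.ofBijective _ (Finite.injective_iff_bijective.1 hinj), fun x y => ?_⟩
  rw [Equiv.ofBijective_apply, Equiv.ofBijective_apply, OrderIso.le_iff_le]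
  rfl

theorem perm_val_eq_of_le {m : ℕ} (e : Equiv.Perm (Fin m)) {x : Fin m} {k : ℕ} (hk : k < m)
    (hlt : ∀ y, (e y).val < k → y ≠ x) (hle : ∀ y, k ≤ (e y).val → e x ≤ e y) :
    (e x).val = k := by
  apply le_antisymm
  · have := hle (e.symm ⟨k, hk⟩) (by rw [Equiv.apply_symm_apply])
    rwa [Equiv.apply_symm_apply, Fin.le_def] at this
  · by_contra h
    exact hlt x (not_le.1 h) rfl

namespace IsRootedWithEdge

variable {m : ℕ} {α : ℝ} {H : SimpleGraph (Fin m)} {f : Fin m → ℝ} {r : Fin m}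
  {p : Fin m → Fin m} {h : Fin m → ℕ} {a b : Fin m}

theorem exists_rec {V : Type*} {H : SimpleGraph V} {r : V} {p : V → V} {h : V → ℕ} {a b : V}
    (R : IsRootedWithEdge H r p h a b) (F : V → ℕ → ℕ) (c : ℕ) :
    ∃ key : V → ℕ, key r = c ∧ ∀ z, z ≠ r → key z = F z (key (p z)) := by
  classical
  let aux : ℕ → V → ℕ := fun n =>
    Nat.rec (fun _ => c) (fun _ g z => if z = r then c else F z (g (p z))) n
  refine ⟨fun z => aux (h z) z, ?_, fun z hz => ?_⟩
  · change aux (h r) r = c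
    rw [R.height_root]
    rfl
  · have : aux (h (p z) + 1) z = if z = r then c else F z (aux (h (p z)) (p z)) := rfl
    dsimp only
    rw [R.height_par z hz, this, if_neg hz]

/-- A preliminary order: by decreasing Perron entries, the triangle first. -/
theorem exists_perm_sort (R : IsRootedWithEdge H r p h a b)
    (ha : ∀ z, z ≠ r → f z ≤ f a) (hb : ∀ z, z ≠ r → z ≠ a → f z ≤ f b) :
    ∃ e : Equiv.Perm (Fin m), (∀ x y, e x ≤ e y → f y ≤ f x) ∧ (∀ z, z ≠ r → e a ≤ e z) ∧
      (∀ z, z ≠ r → z ≠ a → e b ≤ e z) := by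
  classical
  -- Ties in f are broken in favour of the triangle; the last coordinate of the key makes it
  -- injective.
  let g : Fin m → ℕ := fun z => if z = r then 0 else if z = a then 1 else if z = b then 2 else 3
  let key : Fin m → ℝ ×ₗ ℕ ×ₗ Fin m := fun z => toLex (-f z, toLex (g z, z))
  have hkey : Function.Injective key := by
    intro x y hxy
    simpa [key] using (congrArg (fun k => (ofLex (ofLex k).2).2) hxy)
  obtain ⟨e, he⟩ := exists_equiv_of_key key hkey
  have hle : ∀ x y, f y ≤ f x → g x < g y → e x ≤ e y := by
    intro x y h1 h2
    rw [he, Prod.Lex.toLex_le_toLex]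
    rcases h1.lt_or_eq with h1 | h1
    · exact Or.inl (neg_lt_neg h1)
    · exact Or.inr ⟨by rw [h1], Prod.Lex.toLex_le_toLex.2 (Or.inl h2)⟩
  have har := R.left_ne_root
  have hbr := R.right_ne_root
  have hab := R.left_ne_right
  refine ⟨e, fun x y hxy => ?_, fun z hz => ?_, fun z hz hza => ?_⟩
  · rw [he, Prod.Lex.toLex_le_toLex] at hxy
    rcases hxy with h1 | h1
    · exact (neg_lt_neg_iff.1 h1).le
    · exact (neg_injective h1.1).ge
  · by_cases hza : z = a
    · rw [hza]
    · refine hle _ _ (ha z hz) ?_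
      simp only [g, if_neg hz, if_neg hza, if_neg har, if_true]
      split_ifs <;> omega
  · by_cases hzb : z = b
    · rw [hzb]
    · refine hle _ _ (hb z hz hza) ?_
      simp only [g, if_neg hz, if_neg hza, if_neg hbr, if_neg hzb, if_neg hab.symm, if_true]
      omega

/-- A breadth-first order of the vertices along which the Perron entries do not increase. -/
theorem exists_perm_layered (hα : 0 ≤ α) (hf : IsPerronMax α H f)
    (R : IsRootedWithEdge H r p h a b) (hr : ∀ v, f v ≤ f r) (hpa : p a = r) (hpb : p b = r)
    (hba : f b ≤ f a) :
    ∃ e : Equiv.Perm (Fin m), (∀ x y, e x ≤ e y → f y ≤ f x) ∧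
      (∀ x y, e x ≤ e y → e (p x) ≤ e (p y)) ∧ (∀ x, x ≠ r → e (p x) < e x) ∧
      (∀ x, e r ≤ e x) ∧ (∀ z, z ≠ r → e a ≤ e z) ∧ (∀ z, z ≠ r → z ≠ a → e b ≤ e z) := by
  have har := R.left_ne_root
  have hbr := R.right_ne_root
  have hab := R.left_ne_right
  obtain ⟨pos, hpos, hposa, hposb⟩ := R.exists_perm_sort (f := f)
    (fun z hz => by
      by_cases hza : z = a
      · rw [hza]
      by_cases hzb : z = b
      · rw [hzb]; exact hba
      exact R.le_left hα hf hr hpa hpb hz hza hzb)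
    (fun z hz hza => by
      by_cases hzb : z = b
      · rw [hzb]
      exact R.symm.le_left hα hf hr hpb hpa hz hzb hza)
  -- In base m the key of z is the digit 1 followed by the positions along the path from the root to
  -- z. Comparing keys compares heights first and then paths lexicographically. Division by m gives
  -- the key of the parent, which is why the order respects parents.
  obtain ⟨key, hkr, hkz⟩ := R.exists_rec (fun z k => k * m + (pos z).val) 1
  have hm : 2 ≤ m := by
    have h1 := r.isLt
    have h2 := a.isLt
    have h3 : a.val ≠ r.val := fun hh => har (Fin.ext hh)
    omega
  have hdiv : ∀ z, z ≠ r → key z / m = key (p z) := by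
    intro z hz
    rw [hkz z hz, mul_comm, Nat.mul_add_div (by omega), Nat.div_eq_of_lt (pos z).isLt, add_zero]
  have hmod : ∀ z, z ≠ r → key z % m = (pos z).val := by
    intro z hz
    rw [hkz z hz, mul_comm, Nat.mul_add_mod, Nat.mod_eq_of_lt (pos z).isLt]
  have hpar : ∀ z, z ≠ r → key (p z) < key z ∨ key z = 0 := by
    intro z hz
    rcases Nat.eq_zero_or_pos (key z) with h0 | h0
    · exact Or.inr h0
    · left
      rw [← hdiv z hz]
      exact Nat.div_lt_self h0 (by omega)
  have hone : ∀ z, 1 ≤ key z := by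
    intro z
    induction hk : h z using Nat.strong_induction_on generalizing z with
    | _ k ih =>
      by_cases hz : z = r
      · rw [hz, hkr]
      · have h1 := R.height_par z hz
        have h2 := ih (h (p z)) (by omega) (p z) rfl
        rw [hkz z hz]
        exact le_add_right (h2.trans (Nat.le_mul_of_pos_right _ (by omega)))
  have hlt : ∀ z, z ≠ r → key (p z) < key z := fun z hz =>
    (hpar z hz).resolve_right (by have := hone z; omega)
  have hgt : ∀ z, z ≠ r → m + (pos z).val ≤ key z := by
    intro z hz
    rw [hkz z hz]
    exact Nat.add_le_add_right (Nat.le_mul_of_pos_left _ (hone _)) _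
  have hinj : Function.Injective key := by
    intro x y hxy
    by_cases hx : x = r
    · by_cases hy : y = r
      · rw [hx, hy]
      · have := hgt y hy
        rw [← hxy, hx, hkr] at this
        omega
    · by_cases hy : y = r
      · have := hgt x hx
        rw [hxy, hy, hkr] at this
        omega
      · have h1 := hmod x hx
        rw [hxy, hmod y hy] at h1
        exact pos.injective (Fin.ext h1.symm)
  have hmono : ∀ x y, key x ≤ key y → key (p x) ≤ key (p y) := by
    intro x y hxy
    by_cases hx : x = r
    · rw [hx, R.par_root, hkr]; exact hone _
    · by_cases hy : y = r
      · have := hgt x hx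
        rw [hy, hkr] at hxy
        omega
      · rw [← hdiv x hx, ← hdiv y hy]
        exact Nat.div_le_div_right hxy
  have hanc : ∀ {c z}, IsAncestor p c z → key c ≤ key z := by
    rintro c z ⟨k, rfl⟩
    induction k generalizing z with
    | zero => exact le_rfl
    | succ k ih =>
      rw [Function.iterate_succ_apply]
      refine ih.trans ?_
      by_cases hz : z = r
      · rw [hz, R.par_root]
      · exact (hlt z hz).le
  -- Different parents are compared by induction and `le_of_par_le`; among siblings the preliminary
  -- order decides.
  have hanti : ∀ y x, key x ≤ key y → f y ≤ f x := by
    intro y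
    induction hk : key y using Nat.strong_induction_on generalizing y with
    | _ k ih =>
      subst hk
      intro x hxy
      by_cases hx : x = r
      · rw [hx]; exact hr y
      by_cases hy : y = r
      · have := hgt x hx
        rw [hy, hkr] at hxy
        omega
      rcases (hmono x y hxy).lt_or_eq with h1 | h1
      · refine R.le_of_par_le hα hf hr hpa hpb hx hy (fun hh => ?_) (fun hh => ?_)
          (ih _ (hlt y hy) (p y) rfl (p x) h1.le)
        · rw [hh] at h1; exact lt_irrefl _ h1
        · exact absurd (hanc hh) (not_le.2 h1)
      · apply hpos
        rw [hkz x hx, hkz y hy, h1] at hxy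
        exact Nat.le_of_add_le_add_left hxy
  obtain ⟨e, he⟩ := exists_equiv_of_key key hinj
  have hka : key a = m + (pos a).val := by rw [hkz a har, hpa, hkr, one_mul]
  have hkb : key b = m + (pos b).val := by rw [hkz b hbr, hpb, hkr, one_mul]
  refine ⟨e, fun x y hxy => hanti y x ((he x y).1 hxy), fun x y hxy => ?_, fun x hx => ?_,
    fun x => ?_, fun z hz => ?_, fun z hz hza => ?_⟩
  · rw [he] at hxy ⊢
    exact hmono x y hxy
  · rw [← not_le, he, not_le]
    exact hlt x hx
  · rw [he, hkr]
    exact hone x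
  · rw [he, hka]
    exact (Nat.add_le_add_left (hposa z hz) m).trans (hgt z hz)
  · rw [he, hkb]
    exact (Nat.add_le_add_left (hposb z hz hza) m).trans (hgt z hz)

theorem isLayeredUnicyclic (R : IsRootedWithEdge H r p h a b) (hpa : p a = r) (hpb : p b = r)
    {e : Equiv.Perm (Fin m)} (he : ∀ x y, e x ≤ e y → e (p x) ≤ e (p y))
    (hlt : ∀ x, x ≠ r → e (p x) < e x) (hroot : ∀ x, e r ≤ e x) (ha : ∀ z, z ≠ r → e a ≤ e z)
    (hb : ∀ z, z ≠ r → z ≠ a → e b ≤ e z) :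
    IsLayeredUnicyclic (H.map e) (fun i => e (p (e.symm i))) := by
  have har := R.left_ne_root
  have hbr := R.right_ne_root
  have hab := R.left_ne_right
  have hm : 3 ≤ m := by
    have h1 : ({r, a, b} : Finset (Fin m)).card = 3 :=
      Finset.card_eq_three.2 ⟨r, a, b, har.symm, hbr.symm, hab, rfl⟩
    have h2 := Finset.card_le_univ ({r, a, b} : Finset (Fin m))
    rw [Fintype.card_fin] at h2
    omega
  have hr0 : (e r).val = 0 := perm_val_eq_of_le e (by omega) (fun y hy => by omega)
    fun y _ => hroot y
  have hne0 : ∀ y, (e y).val ≠ 0 ↔ y ≠ r := by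
    intro y
    rw [← hr0, Ne, ← Fin.ext_iff, e.injective.eq_iff]
  have ha1 : (e a).val = 1 := perm_val_eq_of_le e (by omega)
    (fun y hy hya => (hne0 y).2 (hya ▸ har) (by omega))
    fun y hy => ha y ((hne0 y).1 (by omega))
  have heq1 : ∀ y, (e y).val = 1 ↔ y = a := by
    intro y
    rw [← ha1, ← Fin.ext_iff, e.injective.eq_iff]
  have hb2 : (e b).val = 2 := perm_val_eq_of_le e (by omega)
    (fun y hy hyb => by
      have h1 := (hne0 b).2 hbr
      have h2 := (not_congr (heq1 b)).2 hab.symm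
      rw [hyb] at hy
      omega)
    fun y hy => hb y ((hne0 y).1 (by omega)) ((not_congr (heq1 y)).1 (by omega))
  have heq2 : ∀ y, (e y).val = 2 ↔ y = b := by
    intro y
    rw [← hb2, ← Fin.ext_iff, e.injective.eq_iff]
  refine ⟨hm, fun i hi => ?_, fun i hi => ?_, fun i j hij => ?_, fun i j => ?_⟩
  · obtain ⟨x, rfl⟩ := e.surjective i
    rw [Equiv.symm_apply_apply]
    exact hlt x ((hne0 x).1 hi)
  · obtain ⟨x, rfl⟩ := e.surjective i
    rw [Equiv.symm_apply_apply]
    have : x = r ∨ x = a ∨ x = b := by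
      rw [← heq1, ← heq2, ← not_iff_not.2 (hne0 x) |>.trans not_not]
      omega
    rcases this with rfl | rfl | rfl
    · rw [R.par_root, hr0]
    · rw [hpa, hr0]
    · rw [hpb, hr0]
  · obtain ⟨x, rfl⟩ := e.surjective i
    obtain ⟨y, rfl⟩ := e.surjective j
    simp only [Equiv.symm_apply_apply]
    exact he x y hij
  · obtain ⟨x, rfl⟩ := e.surjective i
    obtain ⟨y, rfl⟩ := e.surjective j
    have h1 : (H.map e).Adj (e x) (e y) ↔ H.Adj x y := (SimpleGraph.Iso.map e H).map_adj_iff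
    simp only [Equiv.symm_apply_apply, e.injective.eq_iff, hne0, heq1, heq2]
    rw [h1, R.adj_iff]

end IsRootedWithEdge

/-- An extremal unicyclic graph with a vertex of degree at least `3` is, after a renumbering of
its vertices, layered, with non-increasing degrees. -/
theorem IsPerronMax.exists_isLayeredUnicyclic {m : ℕ} {α : ℝ} (hα : 0 ≤ α)
    {H : SimpleGraph (Fin m)} {f : Fin m → ℝ} (hf : IsPerronMax α H f)
    (hcard : Nat.card H.edgeSet = m) (hd : ∃ v, 3 ≤ (H.neighborSet v).ncard) :
    ∃ (e : Equiv.Perm (Fin m)) (q : Fin m → Fin m), IsLayeredUnicyclic (H.map e) q ∧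
      Antitone fun i => (H.neighborSet (e.symm i)).ncard := by
  obtain ⟨v, hv⟩ := hd
  have hne : Nonempty (Fin m) := ⟨v⟩
  -- Rooting at a largest entry transfers the degree bound to the root.
  obtain ⟨r, hr⟩ := Finite.exists_max f
  have hdr := hv.trans (hf.ncard_le hα (hr v))
  obtain ⟨p, h, a, b, R₀⟩ := exists_isRootedWithEdge hf.connected
    (by rw [hcard, Fintype.card_fin]) r
  obtain ⟨a, b, R, hba⟩ : ∃ a b, IsRootedWithEdge H r p h a b ∧ f b ≤ f a := by
    rcases le_total (f b) (f a) with hba | hba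
    · exact ⟨a, b, R₀, hba⟩
    · exact ⟨b, a, R₀.symm, hba⟩
  have hpa := R.par_left_eq_root hα hf hr hdr
  have hpb := R.symm.par_left_eq_root hα hf hr hdr
  obtain ⟨e, h1, h2, h3, h4, h5, h6⟩ := R.exists_perm_layered hα hf hr hpa hpb hba
  refine ⟨e, _, R.isLayeredUnicyclic hpa hpb h2 h3 h4 h5 h6, fun i j hij => ?_⟩
  refine hf.ncard_le hα (h1 _ _ ?_)
  rwa [Equiv.apply_symm_apply, Equiv.apply_symm_apply]

end Ordering

/-! ### Identification of the maximal graph. -/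

section Main

/-- A cycle through a vertex of a 2-regular graph covers its component, here everything. The
resulting injection of the cycle graph is onto, and reflects adjacency because all neighbourhoods on
both sides have two elements. -/
theorem nonempty_iso_cycleGraph {m : ℕ} (hm : 3 ≤ m) {H : SimpleGraph (Fin m)} (hH : H.Connected)
    (hd : ∀ v, (H.neighborSet v).ncard = 2) : Nonempty (H ≃g SimpleGraph.cycleGraph m) := by
  classical
  obtain ⟨v⟩ := hH.nonempty
  have hcyc : H.IsCycles := fun v _ => hd v
  obtain ⟨w, hw, hverts⟩ := hcyc.exists_cycle_toSubgraph_verts_eq_connectedComponentSupp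
    (c := H.connectedComponentMk v) (v := v) rfl
    (Set.nonempty_of_ncard_ne_zero (by rw [hd v]; norm_num))
  have hall : ∀ x, x ∈ w.support := by
    intro x
    rw [← w.mem_verts_toSubgraph, hverts, SimpleGraph.ConnectedComponent.mem_supp_iff,
      SimpleGraph.ConnectedComponent.eq]
    exact hH.preconnected x v
  have hlen : w.length = m := by
    have h1 : w.support.tail.toFinset = Finset.univ := by
      rw [Finset.eq_univ_iff_forall]
      intro x
      rw [List.mem_toFinset]
      have hx := hall x
      rw [← SimpleGraph.Walk.cons_tail_support, List.mem_cons] at hx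
      rcases hx with rfl | hx
      · exact SimpleGraph.Walk.end_mem_tail_support hw.not_nil
      · exact hx
    have h2 := List.toFinset_card_of_nodup hw.support_nodup
    rw [h1, Finset.card_univ, Fintype.card_fin, List.length_tail,
      SimpleGraph.Walk.length_support] at h2
    omega
  obtain ⟨φ⟩ := (SimpleGraph.cycleGraph_isContained_iff (by omega)).2 ⟨v, w, hw, hlen⟩
  have hbij : Function.Bijective φ := Finite.injective_iff_bijective.1 φ.injective
  refine ⟨(⟨Equiv.ofBijective φ hbij, fun {x y} => ?_⟩ : SimpleGraph.cycleGraph m ≃g H).symm⟩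
  rw [Equiv.ofBijective_apply, Equiv.ofBijective_apply]
  refine ⟨fun hxy => ?_, fun hxy => φ.toHom.map_adj hxy⟩
  obtain ⟨k, rfl⟩ : ∃ k, m = k + 3 := ⟨m - 3, by omega⟩
  have hsub : φ '' ((SimpleGraph.cycleGraph (k + 3)).neighborSet x) ⊆ H.neighborSet (φ x) := by
    rintro _ ⟨z, hz, rfl⟩
    exact φ.toHom.map_adj hz
  have hcard : (H.neighborSet (φ x)).ncard ≤
      (φ '' ((SimpleGraph.cycleGraph (k + 3)).neighborSet x)).ncard := by
    rw [hd, Set.ncard_image_of_injective _ hbij.1, Set.ncard_eq_toFinset_card',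
      Set.toFinset_card, SimpleGraph.card_neighborSet_eq_degree,
      SimpleGraph.cycleGraph_degree_three_le]
  have heq := Set.eq_of_subset_of_ncard_le hsub hcard (Set.toFinite _)
  have : φ y ∈ H.neighborSet (φ x) := hxy
  rw [← heq] at this
  obtain ⟨z, hz, hzy⟩ := this
  rw [← φ.injective hzy]
  exact hz

/-- A graph with as many edges as vertices that is not `2`-regular has a vertex of degree at least
`3`. -/
theorem exists_three_le_ncard {m : ℕ} {H : SimpleGraph (Fin m)} (hcard : Nat.card H.edgeSet = m)
    (hd : ∃ v, (H.neighborSet v).ncard ≠ 2) : ∃ v, 3 ≤ (H.neighborSet v).ncard := by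
  by_contra! hlt
  obtain ⟨v, hv⟩ := hd
  have hs := sum_ncard_neighborSet H
  have : ∑ i, (H.neighborSet i).ncard < ∑ _i : Fin m, 2 :=
    Finset.sum_lt_sum (fun i _ => Nat.lt_succ_iff.1 (hlt i))
      ⟨v, Finset.mem_univ v, by have := hlt v; omega⟩
  rw [hs, hcard, Finset.sum_const, Finset.card_univ, Fintype.card_fin, smul_eq_mul] at this
  omega

/-- The structure of a maximal graph whose reduced sequence is not constant. -/
theorem exists_layered_of_isThetaMaximal {α : ℝ} (hα : 0 ≤ α) {n t : ℕ} (ht : t + 3 ≤ n)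
    {π : Fin n → ℕ} (hπ : Antitone π) {G : SimpleGraph (Fin n)}
    (hG : IsThetaMaximal α (coneClass π t 1) G) (h2 : ∃ i, reducedSeq π t i ≠ 2) :
    ∃ H : SimpleGraph (Fin (n - t)), IsCyclicOfRank 1 H ∧
      Nonempty (G ≃g graphJoin (⊤ : SimpleGraph (Fin t)) H) ∧
      Nonempty (H ≃g bfsUnicyclic (reducedSeq π t)) ∧
      (∃ q, IsLayeredUnicyclic (bfsUnicyclic (reducedSeq π t)) q) ∧
      Antitone (reducedSeq π t) ∧
      ∀ i, ((bfsUnicyclic (reducedSeq π t)).neighborSet i).ncard = reducedSeq π t i := by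
  obtain ⟨hdeg, H, hH, ⟨e⟩⟩ := hG.1
  obtain ⟨f, hf⟩ := exists_isPerronMax_of_isThetaMaximal (by omega) hG hH e
  obtain ⟨hanti, σ, hσ⟩ := exists_perm_reducedSeq (by omega) hπ G hdeg H e
  have hcard : Nat.card H.edgeSet = n - t := by
    have := hH.2
    rw [Nat.card_eq_fintype_card (α := Fin (n - t)), Fintype.card_fin] at this
    omega
  obtain ⟨i, hi⟩ := h2
  obtain ⟨ε, q, hL, hε⟩ := hf.exists_isLayeredUnicyclic hα hcard
    (exists_three_le_ncard hcard ⟨σ i, by rwa [hσ]⟩)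
  have hred : ∀ i, ((H.map ε).neighborSet i).ncard = reducedSeq π t i := by
    -- Both lists are non-increasing arrangements of the degrees of H, so they agree entry by entry.
    have heq := eq_of_antitone_of_perm hε hanti (σ.trans ε) fun i => by
      simp [hσ]
    intro i
    rw [← heq]
    have := ncard_neighborSet_iso (SimpleGraph.Iso.map ε H) (ε.symm i)
    dsimp only
    rw [← this, SimpleGraph.Iso.map_apply, Equiv.apply_symm_apply]
  have hbfs := hL.eq_bfsUnicyclic hred
  rw [hbfs] at hL hred
  exact ⟨H, hH, ⟨e⟩, ⟨hbfs ▸ SimpleGraph.Iso.map ε H⟩, ⟨q, hL⟩, hanti, hred⟩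

theorem nonempty_iso_extremalConeUnicyclic {α : ℝ} (hα : 0 ≤ α) {n t : ℕ} (ht : t + 3 ≤ n)
    {π : Fin n → ℕ} (hπ : Antitone π) {G : SimpleGraph (Fin n)}
    (hG : IsThetaMaximal α (coneClass π t 1) G) :
    Nonempty (G ≃g extremalConeUnicyclic π t) := by
  unfold extremalConeUnicyclic
  split_ifs with h2
  · obtain ⟨hdeg, H, hH, ⟨e⟩⟩ := hG.1
    obtain ⟨-, σ, hσ⟩ := exists_perm_reducedSeq (by omega) hπ G hdeg H e
    obtain ⟨e'⟩ := nonempty_iso_cycleGraph (by omega) hH.1 fun v => by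
      have := hσ (σ.symm v)
      rwa [Equiv.apply_symm_apply, h2] at this
    exact ⟨e.trans (graphJoinCongr _ e')⟩
  · push Not at h2
    obtain ⟨H, -, ⟨e⟩, ⟨e'⟩, -⟩ := exists_layered_of_isThetaMaximal hα ht hπ hG h2
    exact ⟨e.trans (graphJoinCongr _ e')⟩

theorem exists_isThetaMaximal (α : ℝ) {n : ℕ} {𝒢 : Set (SimpleGraph (Fin n))}
    (h𝒢 : 𝒢.Nonempty) : ∃ G, IsThetaMaximal α 𝒢 G := by
  obtain ⟨G, hG, hmax⟩ := Set.exists_max_image 𝒢 (fun G => generalSpectralRadius G α)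
    (Set.toFinite _) h𝒢
  exact ⟨G, hG, hmax⟩

theorem IsCyclicOfRank.of_iso {V W : Type*} {c : ℕ} {H : SimpleGraph V} {H' : SimpleGraph W}
    (h : IsCyclicOfRank c H) (e : H ≃g H') : IsCyclicOfRank c H' := by
  refine ⟨e.connected_iff.1 h.1, ?_⟩
  rw [← Nat.card_congr e.mapEdgeSet, ← Nat.card_congr e.toEquiv]
  exact h.2

theorem theorem4p4 (α : ℝ) (hα : 0 ≤ α) (n t : ℕ) (ht : t + 3 ≤ n)
    (π : Fin n → ℕ) (hπ : Antitone π) (hΓ : (coneClass π t 1).Nonempty) :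
    (∀ G : SimpleGraph (Fin n), IsThetaMaximal α (coneClass π t 1) G ↔
      Nonempty (G ≃g extremalConeUnicyclic π t)) ∧
    ((∃ i, reducedSeq π t i ≠ 2) →
      IsCyclicOfRank 1 (bfsUnicyclic (reducedSeq π t)) ∧
      (∀ i, ((bfsUnicyclic (reducedSeq π t)).neighborSet i).ncard = reducedSeq π t i) ∧
      IsBFSOrdering (bfsUnicyclic (reducedSeq π t)) ⟨0, by omega⟩ ∧
      (∀ i j : Fin (n - t), i.val < 3 → j.val < 3 → i ≠ j →
        (bfsUnicyclic (reducedSeq π t)).Adj i j) ∧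
      (∀ (v : Fin (n - t)) (p : (bfsUnicyclic (reducedSeq π t)).Walk v v), p.IsCycle →
        ∀ i : Fin (n - t), i ∈ p.support ↔ i.val < 3)) := by
  have : Nonempty (Fin n) := ⟨⟨0, by omega⟩⟩
  obtain ⟨G₀, hG₀⟩ := exists_isThetaMaximal α hΓ
  obtain ⟨e₀⟩ := nonempty_iso_extremalConeUnicyclic hα ht hπ hG₀
  refine ⟨fun G => ⟨nonempty_iso_extremalConeUnicyclic hα ht hπ, ?_⟩, fun h2 => ?_⟩
  · rintro ⟨e⟩
    have ε : G₀ ≃g G := e₀.trans e.symm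
    refine ⟨mem_coneClass_of_iso hG₀.1 ε, fun G' hG' => ?_⟩
    rw [← generalSpectralRadius_iso α ε]
    exact hG₀.2 G' hG'
  · obtain ⟨H, hH, -, ⟨e⟩, ⟨q, L⟩, hanti, hdeg⟩ :=
      exists_layered_of_isThetaMaximal hα ht hπ hG₀ h2
    -- Connectedness and the edge count of the explicit graph are not computed from its construction
    -- but transported from the unicyclic factor of a maximal graph.
    have hc := hH.of_iso e
    refine ⟨hc, hdeg, L.isBFSOrdering hc.1 rfl fun u v huv => ?_,
      fun i j hi hj hij => L.adj_of_lt_three hi hj hij, fun v p hp => L.mem_support_isCycle_iff hp⟩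
    rw [hdeg, hdeg]
    exact hanti huv

end Main
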